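/- Let $A(\rho)=A_0+\sum_{i=1}^p\rho_iA_i$ with $A_0,\dots,A_p\in\mathbb{R}^{n\times n}$, let $B\in\mathbb{R}^{n\times m}$, and let $\mathcal{P}\subset\mathbb{R}^p$ be a nonempty convex compact polytope. Let $R\succ0$ and $Q\succeq0$ be real symmetric matrices of sizes $m\times m$ and $n\times n$, and suppose that for every $\rho\in\mathcal{P}$ the pair $(A(\rho),B)$ is stabilizable and the pair $(A(\rho),\sqrt{Q})$ is detectable. Call $K\in\mathbb{R}^{m\times n}$ an optimal LQR gain at $\rho$ if for every $x_0\in\mathbb{R}^n$ the feedback $u=-Kx$ attains the minimum of $\int_0^\infty \big(u^\top Ru+x^\top Qx\big)\,dt$ over all $(x,u)$ with $u$ locally integrable on $[0,\infty)$ and $\dot x=A(\rho)x+Bu$, $x(0)=x_0$. Then for every $\rho\in\mathcal{P}$ there is exactly one optimal LQR gain $K^*_\rho$. Put $\mathcal{K}^*=\{K^*_\rho:\rho\in\mathcal{P}\}$. (i) For every $i=1,\dots,mn$ the minimum $\underline K_i$ and the maximum $\overline K_i$ of the $i$-th entry $K_i$ of $\operatorname{vec}(K)$ over all $(K,P,\rho)$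 subject to $$A(\rho)^\top P+PA(\rho)-PBR^{-1}B^\top P+Q=0,\qquad K=R^{-1}B^\top P,\qquad \rho\in\mathcal{P},\qquad P\succeq0$$ exist (are attained), and $\operatorname{vec}(\mathcal{K}^*)\subseteq\mathcal{C}:=\prod_{i=1}^{mn}[\underline K_i,\overline K_i]$. (ii) If, in addition, $(A(\rho),\sqrt{Q})$ is observable for every $\rho\in\mathcal{P}$, then the same holds with the constraint $P\succeq0$ replaced by $P\succ0$: the minimum $\underline K_i$ and the maximum $\overline K_i$ of each $K_i$ over the feasible $(K,P,\rho)$ with $P\succ0$ exist, and $\operatorname{vec}(\mathcal{K}^*)\subseteq\prod_{i=1}^{mn}[\underline K_i,\overline K_i]$. -/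

import Mathlib

open Set Matrix MeasureTheory
open scoped MatrixOrder

noncomputable section

/-- A real square matrix is Hurwitz if all its complex eigenvalues have negative real part. -/
def IsHurwitz {n : ℕ} (M : Matrix (Fin n) (Fin n) ℝ) : Prop :=
  ∀ z ∈ spectrum ℂ (M.map (algebraMap ℝ ℂ)), z.re < 0

/-- The pair `(A, B)` is stabilizable: some state feedback `u = -F x` makes it Hurwitz. -/
def IsStabilizable {n m : ℕ} (A : Matrix (Fin n) (Fin n) ℝ) (B : Matrix (Fin n) (Fin m) ℝ) :
    Prop :=
  ∃ F : Matrix (Fin m) (Fin n) ℝ, IsHurwitz (A - B * F)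

/-- The pair `(A, C)` is detectable: some output injection makes it Hurwitz. -/
def IsDetectable {n q : ℕ} (A : Matrix (Fin n) (Fin n) ℝ) (C : Matrix (Fin q) (Fin n) ℝ) :
    Prop :=
  ∃ L : Matrix (Fin n) (Fin q) ℝ, IsHurwitz (A - L * C)

/-- The pair `(A, C)` is observable: the unobservable subspace `⋂ k, ker (C * A ^ k)` is zero. -/
def IsObservable {n q : ℕ} (A : Matrix (Fin n) (Fin n) ℝ) (C : Matrix (Fin q) (Fin n) ℝ) :
    Prop :=
  ∀ x : Fin n → ℝ, (∀ k : ℕ, (C * A ^ k) *ᵥ x = 0) → x = 0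

/-- The positive semidefinite square root of a positive semidefinite matrix. -/
def matSqrt {n : ℕ} (Q : Matrix (Fin n) (Fin n) ℝ) : Matrix (Fin n) (Fin n) ℝ :=
  CFC.sqrt Q

/-- A (convex, compact) polytope: the convex hull of finitely many points. -/
def IsPolytope {p : ℕ} (S : Set (Fin p → ℝ)) : Prop :=
  ∃ V : Set (Fin p → ℝ), V.Finite ∧ S = convexHull ℝ V

/-- The affine parameter-dependent system matrix `A(ρ) = A₀ + ∑ i, ρ i • A i`. -/
def lpvMatrix {n p : ℕ} (A₀ : Matrix (Fin n) (Fin n) ℝ)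
    (A : Fin p → Matrix (Fin n) (Fin n) ℝ) (ρ : Fin p → ℝ) : Matrix (Fin n) (Fin n) ℝ :=
  A₀ + ∑ i, ρ i • A i

/-- `(x, u)` is a (Carathéodory) trajectory of `x' = A x + B u`, `x 0 = x₀` on `[0, ∞)`, with a
locally integrable input `u`. -/
structure IsTrajectory {n m : ℕ} (A : Matrix (Fin n) (Fin n) ℝ) (B : Matrix (Fin n) (Fin m) ℝ)
    (x₀ : Fin n → ℝ) (x : ℝ → Fin n → ℝ) (u : ℝ → Fin m → ℝ) : Prop where
  continuousOn : ContinuousOn x (Ici 0)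
  locallyIntegrable : ∀ T : ℝ, 0 ≤ T → IntervalIntegrable u volume 0 T
  integral_eq : ∀ t : ℝ, 0 ≤ t → x t = x₀ + ∫ s in (0 : ℝ)..t, (A *ᵥ x s + B *ᵥ u s)

/-- The quadratic cost `∫₀^∞ uᵀ R u + xᵀ Q x dt`, with values in `[0, ∞]`. -/
def lqrCost {n m : ℕ} (Q : Matrix (Fin n) (Fin n) ℝ) (R : Matrix (Fin m) (Fin m) ℝ)
    (x : ℝ → Fin n → ℝ) (u : ℝ → Fin m → ℝ) : ENNReal :=
  ∫⁻ t in Ioi (0 : ℝ), ENNReal.ofReal (u t ⬝ᵥ (R *ᵥ u t) + x t ⬝ᵥ (Q *ᵥ x t))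

/-- `K` is an optimal LQR gain: from every initial state, the closed loop `u = -K x` attains the
minimum of the cost among all trajectories of the system. -/
def IsOptimalGain {n m : ℕ} (A : Matrix (Fin n) (Fin n) ℝ) (B : Matrix (Fin n) (Fin m) ℝ)
    (Q : Matrix (Fin n) (Fin n) ℝ) (R : Matrix (Fin m) (Fin m) ℝ)
    (K : Matrix (Fin m) (Fin n) ℝ) : Prop :=
  ∀ x₀ : Fin n → ℝ, ∃ x : ℝ → Fin n → ℝ,
    IsTrajectory A B x₀ x (fun t => -(K *ᵥ x t)) ∧
    ∀ (y : ℝ → Fin n → ℝ) (v : ℝ → Fin m → ℝ), IsTrajectory A B x₀ y v →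
      lqrCost Q R x (fun t => -(K *ᵥ x t)) ≤ lqrCost Q R y v

/-- The set of the optimal LQR gains of `(A(ρ), B)`, `ρ ∈ S`. -/
def optimalGains {n m p : ℕ} (A : (Fin p → ℝ) → Matrix (Fin n) (Fin n) ℝ)
    (B : Matrix (Fin n) (Fin m) ℝ) (Q : Matrix (Fin n) (Fin n) ℝ)
    (R : Matrix (Fin m) (Fin m) ℝ) (S : Set (Fin p → ℝ)) : Set (Matrix (Fin m) (Fin n) ℝ) :=
  {K | ∃ ρ ∈ S, IsOptimalGain (A ρ) B Q R K}

/-- `P` solves the continuous-time algebraic Riccati equation. -/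
def SolvesCARE {n m : ℕ} (A : Matrix (Fin n) (Fin n) ℝ) (B : Matrix (Fin n) (Fin m) ℝ)
    (Q : Matrix (Fin n) (Fin n) ℝ) (R : Matrix (Fin m) (Fin m) ℝ)
    (P : Matrix (Fin n) (Fin n) ℝ) : Prop :=
  Aᵀ * P + P * A - P * B * R⁻¹ * Bᵀ * P + Q = 0

/-- The triples `(K, P, ρ)` satisfying the CARE at `ρ`, `K = R⁻¹ Bᵀ P`, `ρ ∈ S` and `P ≻ 0`. -/
def feasibleDef {n m p : ℕ} (A : (Fin p → ℝ) → Matrix (Fin n) (Fin n) ℝ)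
    (B : Matrix (Fin n) (Fin m) ℝ) (Q : Matrix (Fin n) (Fin n) ℝ)
    (R : Matrix (Fin m) (Fin m) ℝ) (S : Set (Fin p → ℝ)) :
    Set (Matrix (Fin m) (Fin n) ℝ × Matrix (Fin n) (Fin n) ℝ × (Fin p → ℝ)) :=
  {(K, P, ρ) | SolvesCARE (A ρ) B Q R P ∧ K = R⁻¹ * Bᵀ * P ∧ ρ ∈ S ∧ P.PosDef}

/-- The same feasible set with `P ⪰ 0` in place of `P ≻ 0`. -/
def feasibleSemidef {n m p : ℕ} (A : (Fin p → ℝ) → Matrix (Fin n) (Fin n) ℝ)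
    (B : Matrix (Fin n) (Fin m) ℝ) (Q : Matrix (Fin n) (Fin n) ℝ)
    (R : Matrix (Fin m) (Fin m) ℝ) (S : Set (Fin p → ℝ)) :
    Set (Matrix (Fin m) (Fin n) ℝ × Matrix (Fin n) (Fin n) ℝ × (Fin p → ℝ)) :=
  {(K, P, ρ) | SolvesCARE (A ρ) B Q R P ∧ K = R⁻¹ * Bᵀ * P ∧ ρ ∈ S ∧ P.PosSemidef}

/-- `lo i` and `hi i` are the (attained) minimum and maximum of the `i`-th entry of `vec K` over
the feasible set `F` of triples `(K, P, ρ)`. -/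
def AreOptimalBounds {n m p : ℕ}
    (F : Set (Matrix (Fin m) (Fin n) ℝ × Matrix (Fin n) (Fin n) ℝ × (Fin p → ℝ)))
    (lo hi : Fin n × Fin m → ℝ) : Prop :=
  ∀ i, IsLeast ((fun z => z.1.vec i) '' F) (lo i) ∧
    IsGreatest ((fun z => z.1.vec i) '' F) (hi i)

/-- The hyperrectangle `∏ i, [lo i, hi i]`. -/
def hyperrectangle {n m : ℕ} (lo hi : Fin n × Fin m → ℝ) : Set (Fin n × Fin m → ℝ) :=
  univ.pi fun i => Icc (lo i) (hi i)

end

/-!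
If `P` is symmetric with Riccati residual `ℛ(P) = Aᵀ P + P A - P B R⁻¹ Bᵀ P + Q` and
`K = R⁻¹ Bᵀ P`, then along every trajectory
`uᵀ R u + xᵀ Q x + (xᵀ P x)' = (u + K x)ᵀ R (u + K x) + xᵀ ℛ(P) x`.

Existence of a positive semidefinite solution of the Riccati equation comes from a compactness
argument. On the set of `P ⪰ 0` with `ℛ(P) ⪯ 0` and trace at most that of the cost matrix of a
stabilizing feedback, take a minimizer of the trace. By detectability its gain is stabilizing, so
one step of policy iteration yields a smaller element of the set, which must be the minimizer
itself, and then `ℛ(P) = 0`.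

For such a solution, integrating the identity shows that `u = -K x` has cost at most `x₀ᵀ P x₀`.
Detectability forces the state of any trajectory of finite cost to be square integrable, so
`xᵀ P x` is small at arbitrarily late times and no trajectory does better; equality makes
`u + K x` vanish, so the optimal gain is unique and every solution `P ⪰ 0` gives the same one.

The Lyapunov matrix of one stabilized closed loop serves for all nearby parameters and bounds the
solutions there, so over a compact parameter set the feasible triples `(K, P, ρ)` form a compact
set that contains all optimal gains. Under observability the kernel of a solution `P ⪰ 0` is an
unobservable invariant subspace, hence zero, so that `P ≻ 0` automatically.
-/

open Filter Topology

section QuadraticForms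

variable {ι κ : Type*} [Fintype ι] [Fintype κ]

theorem dotProduct_mulVec_comm_of_isHermitian {X : Matrix ι ι ℝ} (hX : X.IsHermitian)
    (x y : ι → ℝ) : x ⬝ᵥ (X *ᵥ y) = y ⬝ᵥ (X *ᵥ x) := by
  rw [← dotProduct_transpose_mulVec, (isHermitian_iff_isSymm.1 hX).eq]

theorem posSemidef_iff_isHermitian_and_quadratic_nonneg {X : Matrix ι ι ℝ} :
    X.PosSemidef ↔ X.IsHermitian ∧ ∀ x, 0 ≤ x ⬝ᵥ (X *ᵥ x) := by
  simp [posSemidef_iff_dotProduct_mulVec]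

theorem posDef_iff_isHermitian_and_quadratic_pos {X : Matrix ι ι ℝ} :
    X.PosDef ↔ X.IsHermitian ∧ ∀ x, x ≠ 0 → 0 < x ⬝ᵥ (X *ᵥ x) := by
  simp [posDef_iff_dotProduct_mulVec]

theorem quadratic_nonneg {X : Matrix ι ι ℝ} (hX : X.PosSemidef) (x : ι → ℝ) :
    0 ≤ x ⬝ᵥ (X *ᵥ x) :=
  (posSemidef_iff_isHermitian_and_quadratic_nonneg.1 hX).2 x

theorem quadratic_pos {X : Matrix ι ι ℝ} (hX : X.PosDef) {x : ι → ℝ} (hx : x ≠ 0) :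
    0 < x ⬝ᵥ (X *ᵥ x) :=
  (posDef_iff_isHermitian_and_quadratic_pos.1 hX).2 x hx

theorem mulVec_eq_zero_of_quadratic_eq_zero {X : Matrix ι ι ℝ} (hX : X.PosSemidef) {x : ι → ℝ}
    (hx : x ⬝ᵥ (X *ᵥ x) = 0) : X *ᵥ x = 0 :=
  (hX.dotProduct_mulVec_zero_iff x).1 (by simpa using hx)

theorem eq_zero_of_quadratic_eq_zero {X : Matrix ι ι ℝ} (hX : X.IsHermitian)
    (h : ∀ x, x ⬝ᵥ (X *ᵥ x) = 0) : X = 0 := by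
  classical
  have hpos : X.PosSemidef :=
    posSemidef_iff_isHermitian_and_quadratic_nonneg.2 ⟨hX, fun x => (h x).ge⟩
  ext i j
  simpa using congrFun (mulVec_eq_zero_of_quadratic_eq_zero hpos (h (Pi.single j 1))) i

theorem nonpos_iff_quadratic_nonpos {X : Matrix ι ι ℝ} (hX : X.IsHermitian) :
    X ≤ 0 ↔ ∀ x, x ⬝ᵥ (X *ᵥ x) ≤ 0 := by
  simp [le_iff, posSemidef_iff_isHermitian_and_quadratic_nonneg, isHermitian_iff_isSymm.1 hX,
    neg_mulVec]

theorem dotProduct_self_nonneg (x : ι → ℝ) : 0 ≤ x ⬝ᵥ x := by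
  simpa using dotProduct_star_self_nonneg x

theorem dotProduct_self_pos {x : ι → ℝ} (hx : x ≠ 0) : 0 < x ⬝ᵥ x :=
  (dotProduct_self_nonneg x).lt_of_ne' fun h => hx (dotProduct_self_eq_zero.1 h)

theorem sq_apply_le_dotProduct_self (x : ι → ℝ) (i : ι) : x i ^ 2 ≤ x ⬝ᵥ x := by
  rw [sq]
  exact Finset.single_le_sum (f := fun i => x i * x i) (fun i _ => mul_self_nonneg (x i))
    (Finset.mem_univ i)

theorem posSemidef_transpose_mul_self {ι : Type*} [Finite ι] (C : Matrix κ ι ℝ) :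
    (Cᵀ * C).PosSemidef := by
  simpa using posSemidef_conjTranspose_mul_self C

theorem dotProduct_transpose_mul_self_mulVec (C : Matrix κ ι ℝ) (x : ι → ℝ) :
    x ⬝ᵥ ((Cᵀ * C) *ᵥ x) = (C *ᵥ x) ⬝ᵥ (C *ᵥ x) := by
  rw [← mulVec_mulVec, dotProduct_transpose_mulVec]

theorem abs_quadratic_le (E : Matrix ι ι ℝ) (x : ι → ℝ) :
    |x ⬝ᵥ (E *ᵥ x)| ≤ (∑ i, ∑ j, |E i j|) * (x ⬝ᵥ x) := by
  have hentry : ∀ i j, |x i * x j| ≤ x ⬝ᵥ x := fun i j => by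
    have hi := sq_apply_le_dotProduct_self x i
    have hj := sq_apply_le_dotProduct_self x j
    rw [abs_le]
    constructor <;> nlinarith [sq_nonneg (x i - x j), sq_nonneg (x i + x j)]
  calc |x ⬝ᵥ (E *ᵥ x)| = |∑ i, ∑ j, E i j * (x i * x j)| := by
        simp only [dotProduct, mulVec, Finset.mul_sum]
        congr! 3
        ring
    _ ≤ ∑ i, ∑ j, |E i j| * |x i * x j| := by
        refine (Finset.abs_sum_le_sum_abs _ _).trans (Finset.sum_le_sum fun i _ => ?_)
        simpa only [abs_mul] using Finset.abs_sum_le_sum_abs (fun j => E i j * (x i * x j)) _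
    _ ≤ ∑ i, ∑ j, |E i j| * (x ⬝ᵥ x) := by
        gcongr with i _ j _
        exact hentry i j
    _ = (∑ i, ∑ j, |E i j|) * (x ⬝ᵥ x) := by simp only [Finset.sum_mul]

theorem exists_quadratic_le_mul_dotProduct_self (E : Matrix ι ι ℝ) :
    ∃ c : ℝ, 0 ≤ c ∧ ∀ x, x ⬝ᵥ (E *ᵥ x) ≤ c * (x ⬝ᵥ x) :=
  ⟨∑ i, ∑ j, |E i j|, by positivity, fun x => (le_abs_self _).trans (abs_quadratic_le E x)⟩

theorem exists_young_dotProduct_mulVec (E : Matrix ι κ ℝ) :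
    ∃ c : ℝ, 0 ≤ c ∧ ∀ x y, x ⬝ᵥ (E *ᵥ y) ≤ 1 / 4 * (x ⬝ᵥ x) + c * (y ⬝ᵥ y) := by
  obtain ⟨c, hc, hE⟩ := exists_quadratic_le_mul_dotProduct_self (Eᵀ * E)
  refine ⟨c, hc, fun x y => ?_⟩
  have hsq := dotProduct_self_nonneg (x - (2 : ℝ) • (E *ᵥ y))
  have hEy := hE y
  rw [dotProduct_transpose_mul_self_mulVec] at hEy
  simp only [sub_dotProduct, dotProduct_sub, smul_dotProduct, dotProduct_smul, smul_eq_mul,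
    dotProduct_comm (E *ᵥ y) x] at hsq
  linarith

theorem abs_apply_le_trace_of_posSemidef {P : Matrix ι ι ℝ} (hP : P.PosSemidef) (i j : ι) :
    |P i j| ≤ P.trace := by
  classical
  have hdiag : ∀ k, P k k ≤ P.trace := fun k =>
    Finset.single_le_sum (f := fun k => P k k) (fun k _ => hP.diag_nonneg) (Finset.mem_univ k)
  have hsymm : P j i = P i j := by simpa using hP.isHermitian.apply i j
  have hadd := quadratic_nonneg hP (Pi.single i 1 + Pi.single j 1)
  have hsub := quadratic_nonneg hP (Pi.single i 1 - Pi.single j 1)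
  simp only [mulVec_add, mulVec_sub, add_dotProduct, sub_dotProduct, dotProduct_add,
    dotProduct_sub, mulVec_single_one, single_one_dotProduct, col_apply] at hadd hsub
  rw [abs_le]
  constructor <;> linarith [hdiag i, hdiag j]

theorem isClosed_setOf_posSemidef {ι : Type*} [Finite ι] :
    IsClosed {P : Matrix ι ι ℝ | P.PosSemidef} := by
  have := Fintype.ofFinite ι
  simp only [posSemidef_iff_isHermitian_and_quadratic_nonneg, ofPred_and, ofPred_forall]
  exact (isClosed_eq (by fun_prop) continuous_id).inter
    (isClosed_iInter fun x => isClosed_le (by fun_prop) (by fun_prop))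

theorem isCompact_setOf_posSemidef_and_trace_le (c : ℝ) :
    IsCompact {P : Matrix ι ι ℝ | P.PosSemidef ∧ P.trace ≤ c} := by
  have hbox : IsCompact (univ.pi fun _ : ι => univ.pi fun _ : ι => Icc (-c) c) :=
    isCompact_univ_pi fun _ => isCompact_univ_pi fun _ => isCompact_Icc
  refine hbox.of_isClosed_subset
    (isClosed_setOf_posSemidef.inter (isClosed_le continuous_id.matrix_trace continuous_const))
    fun P hP i _ j _ => ?_
  exact abs_le.1 ((abs_apply_le_trace_of_posSemidef hP.1 i j).trans hP.2)

theorem trace_mono {P P' : Matrix ι ι ℝ} (h : P' ≤ P) : P'.trace ≤ P.trace := by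
  simpa only [trace_sub, sub_nonneg] using (le_iff.1 h).trace_nonneg

theorem eq_of_le_of_trace_le {P P' : Matrix ι ι ℝ} (h : P' ≤ P) (ht : P.trace ≤ P'.trace) :
    P' = P := by
  ext i j
  have hentry := abs_apply_le_trace_of_posSemidef (le_iff.1 h) i j
  rw [trace_sub, Matrix.sub_apply] at hentry
  linarith [abs_nonpos_iff.1 (hentry.trans (sub_nonpos.2 ht))]

theorem isCompact_setOf_dotProduct_self_eq_one : IsCompact {x : ι → ℝ | x ⬝ᵥ x = 1} := by
  have hbox : IsCompact (univ.pi fun _ : ι => Icc (-1 : ℝ) 1) :=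
    isCompact_univ_pi fun _ => isCompact_Icc
  refine hbox.of_isClosed_subset (isClosed_eq (by fun_prop) (by fun_prop)) fun x hx i _ => ?_
  exact abs_le.1 ((sq_le_one_iff_abs_le_one _).1
    ((sq_apply_le_dotProduct_self x i).trans_eq hx))

theorem exists_rayleigh_quotient_min [Nonempty ι] (X : Matrix ι ι ℝ) {W : Matrix ι ι ℝ}
    (hW : W.PosDef) : ∃ (μ : ℝ) (v : ι → ℝ), v ≠ 0 ∧ v ⬝ᵥ (X *ᵥ v) = μ * (v ⬝ᵥ (W *ᵥ v)) ∧
      ∀ x, μ * (x ⬝ᵥ (W *ᵥ x)) ≤ x ⬝ᵥ (X *ᵥ x) := by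
  have hscale : ∀ (Y : Matrix ι ι ℝ) (c : ℝ) (x : ι → ℝ),
      (c • x) ⬝ᵥ (Y *ᵥ (c • x)) = c ^ 2 * (x ⬝ᵥ (Y *ᵥ x)) := fun Y c x => by
    simp only [mulVec_smul, smul_dotProduct, dotProduct_smul, smul_eq_mul]
    ring
  have hunit : ∀ x : ι → ℝ, x ≠ 0 → ((√(x ⬝ᵥ x))⁻¹ • x) ⬝ᵥ ((√(x ⬝ᵥ x))⁻¹ • x) = 1 :=
    fun x hx => by
      have hxx := dotProduct_self_pos hx
      rw [smul_dotProduct, dotProduct_smul, smul_smul, smul_eq_mul, ← mul_inv,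
        Real.mul_self_sqrt hxx.le, inv_mul_cancel₀ hxx.ne']
  have hne : ∀ x : ι → ℝ, x ⬝ᵥ x = 1 → x ≠ 0 := by
    rintro x hx rfl
    simp at hx
  obtain ⟨v, hv, hmin⟩ := isCompact_setOf_dotProduct_self_eq_one.exists_isMinOn
    (f := fun x : ι → ℝ => (x ⬝ᵥ (X *ᵥ x)) / (x ⬝ᵥ (W *ᵥ x)))
    ((exists_ne (0 : ι → ℝ)).imp' _ hunit)
    (ContinuousOn.div (by fun_prop) (by fun_prop) fun x hx => (quadratic_pos hW (hne x hx)).ne')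
  refine ⟨_, v, hne v hv, (div_mul_cancel₀ _ (quadratic_pos hW (hne v hv)).ne').symm, fun x => ?_⟩
  rcases eq_or_ne x 0 with rfl | hx
  · simp
  have hle := isMinOn_iff.1 hmin _ (hunit x hx)
  have hpos : 0 < (√(x ⬝ᵥ x))⁻¹ ^ 2 := by
    have := dotProduct_self_pos hx
    positivity
  simp only [hscale] at hle
  rwa [mul_div_mul_left _ _ hpos.ne', le_div_iff₀ (quadratic_pos hW hx)] at hle

theorem exists_dotProduct_self_le_mul_quadratic {R : Matrix ι ι ℝ} (hR : R.PosDef) :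
    ∃ c : ℝ, 0 ≤ c ∧ ∀ x, x ⬝ᵥ x ≤ c * (x ⬝ᵥ (R *ᵥ x)) := by
  classical
  cases isEmpty_or_nonempty ι
  · exact ⟨0, le_rfl, fun x => by simp [dotProduct]⟩
  obtain ⟨μ, v, hv, hmin, hle⟩ := exists_rayleigh_quotient_min R PosDef.one
  simp only [one_mulVec] at hmin hle
  have hμ : 0 < μ := pos_of_mul_pos_left (hmin ▸ quadratic_pos hR hv) (dotProduct_self_nonneg v)
  exact ⟨μ⁻¹, by positivity, fun x => (le_inv_mul_iff₀ hμ).2 (hle x)⟩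

end QuadraticForms

section Hurwitz

variable {ι : Type*} [Fintype ι] [DecidableEq ι] {n : ℕ}

theorem tendsto_pow_zero_of_spectralRadius_lt_one {𝔸 : Type*} [NormedRing 𝔸] [NormedAlgebra ℂ 𝔸]
    [CompleteSpace 𝔸] {a : 𝔸} (ha : spectralRadius ℂ a < 1) :
    Tendsto (fun k : ℕ => a ^ k) atTop (𝓝 0) := by
  obtain ⟨r, har, hr⟩ := ENNReal.lt_iff_exists_nnreal_btwn.1 ha
  have hr1 : (r : ℝ) < 1 := by exact_mod_cast hr
  have hgelfand :=
    (spectrum.pow_nnnorm_pow_one_div_tendsto_nhds_spectralRadius a).eventually_lt_const har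
  refine squeeze_zero_norm' ?_ (tendsto_pow_atTop_nhds_zero_of_lt_one r.coe_nonneg hr1)
  filter_upwards [hgelfand, eventually_gt_atTop 0] with k hk hk0
  have hpow := ENNReal.rpow_le_rpow hk.le k.cast_nonneg
  rw [← ENNReal.rpow_mul, one_div_mul_cancel (by positivity), ENNReal.rpow_one,
    ENNReal.rpow_natCast] at hpow
  exact_mod_cast hpow

open scoped Matrix.Norms.Operator in
theorem tendsto_pow_zero_of_forall_mem_spectrum_norm_lt_one {N : Matrix ι ι ℂ}
    (hN : ∀ z ∈ spectrum ℂ N, ‖z‖ < 1) : Tendsto (fun k : ℕ => N ^ k) atTop (𝓝 0) := by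
  cases isEmpty_or_nonempty ι
  · exact (tendsto_const_nhds (x := 0)).congr fun _ => Subsingleton.elim _ _
  refine tendsto_pow_zero_of_spectralRadius_lt_one ?_
  exact_mod_cast spectrum.spectralRadius_lt_of_forall_lt N (r := 1)
    fun z hz => by exact_mod_cast hN z hz

theorem eventually_norm_one_add_mul_lt_one {z : ℂ} (hz : z.re < 0) :
    ∀ᶠ h : ℝ in 𝓝[>] 0, ‖1 + (h : ℂ) * z‖ < 1 := by
  have hlim : Tendsto (fun h : ℝ => 2 * z.re + h * (z.re ^ 2 + z.im ^ 2)) (𝓝[>] 0)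
      (𝓝 (2 * z.re + 0 * (z.re ^ 2 + z.im ^ 2))) :=
    (Continuous.tendsto (by fun_prop) 0).mono_left nhdsWithin_le_nhds
  filter_upwards [hlim.eventually_lt_const (by linarith : _ < (0 : ℝ)), self_mem_nhdsWithin]
    with h hneg (hpos : 0 < h)
  rw [← sq_lt_one_iff₀ (norm_nonneg _), Complex.sq_norm, Complex.normSq_apply]
  simp only [Complex.add_re, Complex.one_re, Complex.re_ofReal_mul, Complex.add_im,
    Complex.one_im, Complex.im_ofReal_mul]
  nlinarith [mul_neg_of_pos_of_neg hpos hneg]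

theorem spectrum_one_add_smul {𝕜 𝔸 : Type*} [Field 𝕜] [Ring 𝔸] [Algebra 𝕜 𝔸] (a : 𝔸) {h : 𝕜}
    (hh : h ≠ 0) : spectrum 𝕜 (1 + h • a) = (fun z => 1 + h * z) '' spectrum 𝕜 a := by
  have hunit := spectrum.unit_smul_eq_smul a (Units.mk0 h hh)
  rw [Units.smul_mk0] at hunit
  rw [← map_one (algebraMap 𝕜 𝔸), ← spectrum.singleton_add_eq, hunit, singleton_add,
    ← image_smul, image_image]
  rfl

theorem IsHurwitz.exists_euler_step {M : Matrix (Fin n) (Fin n) ℝ} (hM : IsHurwitz M) :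
    ∃ h : ℝ, 0 < h ∧ Tendsto (fun k : ℕ => (1 + h • M) ^ k) atTop (𝓝 0) := by
  set Mc := M.map (algebraMap ℝ ℂ) with hMc
  obtain ⟨h, hdisc, hpos : 0 < h⟩ := (((eventually_all_finite (finite_spectrum Mc)).2
    fun z hz => eventually_norm_one_add_mul_lt_one (hM z hz)).and self_mem_nhdsWithin).exists
  have hspec : ∀ w ∈ spectrum ℂ (1 + (h : ℂ) • Mc), ‖w‖ < 1 := by
    rw [spectrum_one_add_smul Mc (by exact_mod_cast hpos.ne')]
    rintro _ ⟨z, hz, rfl⟩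
    exact hdisc z hz
  have hmap : ∀ k : ℕ, ((1 + (h : ℂ) • Mc) ^ k).map Complex.re = (1 + h • M) ^ k := fun k => by
    have hstep : 1 + (h : ℂ) • Mc = (algebraMap ℝ ℂ).mapMatrix (1 + h • M) := by
      ext i j
      simp [hMc, one_apply, apply_ite]
    ext i j
    rw [hstep, ← map_pow]
    simp
  refine ⟨h, hpos, ?_⟩
  have hre : Continuous fun X : Matrix (Fin n) (Fin n) ℂ => X.map Complex.re :=
    continuous_id.matrix_map Complex.continuous_re
  simpa only [Function.comp_def, hmap, Matrix.map_zero _ Complex.zero_re] using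
    (hre.tendsto 0).comp (tendsto_pow_zero_of_forall_mem_spectrum_norm_lt_one hspec)

/-- `W` defines a strict quadratic Lyapunov function of the system `x' = M x`: along its
trajectories `xᵀ W x` decays at least at the rate `2 xᵀ x`. -/
structure IsLyapunovMatrix {ι : Type*} [Fintype ι] (M W : Matrix ι ι ℝ) : Prop where
  posDef : W.PosDef
  decay : ∀ x, x ⬝ᵥ (W *ᵥ (M *ᵥ x)) ≤ -(x ⬝ᵥ x)

theorem exists_discrete_lyapunov {N : Matrix ι ι ℝ}
    (hN : Tendsto (fun k : ℕ => N ^ k) atTop (𝓝 0)) :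
    ∃ V : Matrix ι ι ℝ, V.PosDef ∧
      ∀ x, (N *ᵥ x) ⬝ᵥ (V *ᵥ (N *ᵥ x)) - x ⬝ᵥ (V *ᵥ x) ≤ -(1 / 2) * (x ⬝ᵥ x) := by
  have hsmall : Tendsto (fun k : ℕ => ∑ i, ∑ j, |((N ^ k)ᵀ * N ^ k) i j|) atTop (𝓝 0) := by
    have hcont : Continuous fun X : Matrix ι ι ℝ => ∑ i, ∑ j, |(Xᵀ * X) i j| :=
      continuous_finsetSum _ fun i _ => continuous_finsetSum _ fun j _ =>
        (Continuous.matrix_elem (by fun_prop) i j).abs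
    simpa [Function.comp_def] using (hcont.tendsto 0).comp hN
  obtain ⟨k, hk, hk0⟩ := ((hsmall.eventually_lt_const one_half_pos).and
    (eventually_gt_atTop 0)).exists
  set q : ℕ → (ι → ℝ) → ℝ := fun l x => ((N ^ l) *ᵥ x) ⬝ᵥ ((N ^ l) *ᵥ x) with hq
  set V := ∑ l ∈ Finset.range k, (N ^ l)ᵀ * N ^ l with hV
  have hVq : ∀ x, x ⬝ᵥ (V *ᵥ x) = ∑ l ∈ Finset.range k, q l x := fun x => by
    simp only [hV, hq, sum_mulVec, dotProduct_sum, dotProduct_transpose_mul_self_mulVec]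
  refine ⟨V, posDef_iff_isHermitian_and_quadratic_pos.2
    ⟨by simp [IsSymm, hV, transpose_sum], fun x hx => ?_⟩, fun x => ?_⟩
  · rw [hVq]
    exact Finset.sum_pos' (fun l _ => dotProduct_self_nonneg _)
      ⟨0, Finset.mem_range.2 hk0, by simpa [hq] using dotProduct_self_pos hx⟩
  · have hshift : ∀ l, q l (N *ᵥ x) = q (l + 1) x := fun l => by
      simp only [hq, mulVec_mulVec, pow_succ]
    have hk_le : q k x ≤ 1 / 2 * (x ⬝ᵥ x) :=
      calc q k x = x ⬝ᵥ (((N ^ k)ᵀ * N ^ k) *ᵥ x) :=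
            (dotProduct_transpose_mul_self_mulVec _ _).symm
        _ ≤ _ := (le_abs_self _).trans (abs_quadratic_le _ x)
        _ ≤ 1 / 2 * (x ⬝ᵥ x) := mul_le_mul_of_nonneg_right hk.le (dotProduct_self_nonneg x)
    have hzero : q 0 x = x ⬝ᵥ x := by simp [hq]
    rw [hVq, hVq, ← Finset.sum_sub_distrib]
    simp only [hshift]
    rw [Finset.sum_range_sub (fun l => q l x)]
    linarith

theorem IsHurwitz.exists_isLyapunovMatrix {M : Matrix (Fin n) (Fin n) ℝ} (hM : IsHurwitz M) :
    ∃ W, IsLyapunovMatrix M W := by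
  obtain ⟨h, hpos, hlim⟩ := hM.exists_euler_step
  obtain ⟨V, hV, hstep⟩ := exists_discrete_lyapunov hlim
  refine ⟨(4 * h) • V, hV.smul (by positivity), fun x => ?_⟩
  have hdecay := hstep x
  have hnonneg := quadratic_nonneg hV.posSemidef (h • (M *ᵥ x))
  have hcomm := dotProduct_mulVec_comm_of_isHermitian hV.isHermitian x (M *ᵥ x)
  simp only [add_mulVec, one_mulVec, mulVec_add, mulVec_smul, add_dotProduct, dotProduct_add,
    smul_dotProduct, dotProduct_smul, smul_eq_mul, smul_mulVec, ← hcomm] at hdecay hnonneg ⊢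
  linarith

end Hurwitz

section Lyapunov

variable {ι : Type*} [Fintype ι] {M W X : Matrix ι ι ℝ}

theorem IsLyapunovMatrix.posSemidef (hW : IsLyapunovMatrix M W) (hX : X.IsHermitian)
    (hXM : ∀ x, x ⬝ᵥ (X *ᵥ (M *ᵥ x)) ≤ 0) : X.PosSemidef := by
  refine posSemidef_iff_isHermitian_and_quadratic_nonneg.2 ⟨hX, fun x => ?_⟩
  cases isEmpty_or_nonempty ι
  · simp [dotProduct]
  obtain ⟨μ, v, hv, hmin, hle⟩ := exists_rayleigh_quotient_min X hW.posDef
  have hYform : ∀ y z, y ⬝ᵥ ((X - μ • W) *ᵥ z) = y ⬝ᵥ (X *ᵥ z) - μ * (y ⬝ᵥ (W *ᵥ z)) :=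
    fun y z => by rw [sub_mulVec, smul_mulVec, dotProduct_sub, dotProduct_smul, smul_eq_mul]
  have hYherm : (X - μ • W).IsHermitian := hX.sub (hW.posDef.isHermitian.smul (.all μ))
  have hY : (X - μ • W).PosSemidef := posSemidef_iff_isHermitian_and_quadratic_nonneg.2
    ⟨hYherm, fun y => by rw [hYform]; exact sub_nonneg.2 (hle y)⟩
  have hYv : (X - μ • W) *ᵥ v = 0 :=
    mulVec_eq_zero_of_quadratic_eq_zero hY (by rw [hYform, hmin, sub_self])
  have hYMv : v ⬝ᵥ (X *ᵥ (M *ᵥ v)) = μ * (v ⬝ᵥ (W *ᵥ (M *ᵥ v))) := by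
    rw [← sub_eq_zero, ← hYform, dotProduct_mulVec_comm_of_isHermitian hYherm, hYv,
      dotProduct_zero]
  have hdecay : v ⬝ᵥ (W *ᵥ (M *ᵥ v)) < 0 :=
    (hW.decay v).trans_lt (neg_neg_of_pos (dotProduct_self_pos hv))
  have hμ : 0 ≤ μ := nonneg_of_mul_nonpos_left (hYMv ▸ hXM v) hdecay
  exact (mul_nonneg hμ (quadratic_nonneg hW.posDef.posSemidef x)).trans (hle x)

theorem dotProduct_lyapunov_mulVec (hX : X.IsHermitian) (M : Matrix ι ι ℝ) (x : ι → ℝ) :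
    x ⬝ᵥ ((Mᵀ * X + X * M) *ᵥ x) = 2 * (x ⬝ᵥ (X *ᵥ (M *ᵥ x))) := by
  rw [add_mulVec, dotProduct_add, ← mulVec_mulVec, ← mulVec_mulVec, dotProduct_transpose_mulVec,
    dotProduct_comm, ← dotProduct_mulVec_comm_of_isHermitian hX]
  ring

theorem isHermitian_lyapunov (hX : X.IsHermitian) (M : Matrix ι ι ℝ) :
    (Mᵀ * X + X * M).IsHermitian := by
  rw [isHermitian_iff_isSymm, IsSymm] at hX ⊢
  rw [transpose_add, transpose_mul, transpose_mul, transpose_transpose, hX, add_comm]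

/-- The Lyapunov operator `X ↦ Mᵀ X + X M` on the symmetric matrices. -/
def lyapunovOperator (M : Matrix ι ι ℝ) :
    selfAdjoint.submodule ℝ (Matrix ι ι ℝ) →ₗ[ℝ] selfAdjoint.submodule ℝ (Matrix ι ι ℝ) where
  toFun X := ⟨Mᵀ * X + X * M, isHermitian_lyapunov X.2 M⟩
  map_add' X Y := by
    ext1
    simp only [Submodule.coe_add]
    noncomm_ring
  map_smul' c X := by
    ext1
    simp [smul_add]

theorem IsLyapunovMatrix.exists_lyapunov_eq (hW : IsLyapunovMatrix M W) {Y : Matrix ι ι ℝ}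
    (hY : Y.IsHermitian) : ∃ X : Matrix ι ι ℝ, X.IsHermitian ∧ Mᵀ * X + X * M = Y := by
  have hinj : Function.Injective (lyapunovOperator M) := by
    refine (injective_iff_map_eq_zero _).2 fun X hX => Subtype.ext ?_
    have hherm : (X : Matrix ι ι ℝ).IsHermitian := X.2
    have hzero : ∀ x, x ⬝ᵥ ((X : Matrix ι ι ℝ) *ᵥ (M *ᵥ x)) = 0 := fun x => by
      have hform := dotProduct_lyapunov_mulVec hherm M x
      rw [show Mᵀ * X.1 + X.1 * M = 0 from congrArg Subtype.val hX] at hform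
      simpa using hform.symm
    have hpos := hW.posSemidef hherm fun x => (hzero x).le
    have hneg := hW.posSemidef hherm.neg fun x => by
      rw [neg_mulVec, dotProduct_neg, hzero, neg_zero]
    exact le_antisymm (neg_nonneg.1 hneg.nonneg) hpos.nonneg
  obtain ⟨X, hX⟩ := LinearMap.injective_iff_surjective.1 hinj ⟨Y, hY⟩
  exact ⟨X, X.2, congrArg Subtype.val hX⟩

end Lyapunov

section Riccati

variable {ι κ γ : Type*} [Fintype ι] [Fintype κ] {A P Q : Matrix ι ι ℝ} {B : Matrix ι κ ℝ}
  {R : Matrix κ κ ℝ} {F : Matrix κ ι ℝ}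

/-- The running cost `uᵀ R u + xᵀ Q x`, in the form in which it appears in `lqrCost`. -/
def runningCost (Q : Matrix ι ι ℝ) (R : Matrix κ κ ℝ) (x : ι → ℝ) (u : κ → ℝ) : ℝ :=
  u ⬝ᵥ (R *ᵥ u) + x ⬝ᵥ (Q *ᵥ x)

theorem runningCost_nonneg (hQ : Q.PosSemidef) (hR : R.PosSemidef) (x : ι → ℝ) (u : κ → ℝ) :
    0 ≤ runningCost Q R x u :=
  add_nonneg (quadratic_nonneg hR u) (quadratic_nonneg hQ x)

theorem runningCost_feedback (Q : Matrix ι ι ℝ) (R : Matrix κ κ ℝ) (F : Matrix κ ι ℝ)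
    (x : ι → ℝ) : runningCost Q R x (-(F *ᵥ x)) = x ⬝ᵥ ((Q + Fᵀ * R * F) *ᵥ x) := by
  rw [runningCost, mulVec_neg, neg_dotProduct_neg, add_mulVec, dotProduct_add, ← mulVec_mulVec,
    ← mulVec_mulVec, dotProduct_transpose_mulVec, dotProduct_comm (R *ᵥ _), add_comm]

theorem sub_mul_mulVec (A : Matrix ι ι ℝ) (B : Matrix ι κ ℝ) (F : Matrix κ ι ℝ) (x : ι → ℝ) :
    (A - B * F) *ᵥ x = A *ᵥ x + B *ᵥ (-(F *ᵥ x)) := by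
  rw [sub_mulVec, mulVec_neg, mulVec_mulVec, sub_eq_add_neg]

/-- `P` is the cost matrix of the feedback `u = -F x`: along the closed loop, `xᵀ P x` decreases
exactly at the rate given by the running cost. -/
structure IsFeedbackCost (A : Matrix ι ι ℝ) (B : Matrix ι κ ℝ) (Q : Matrix ι ι ℝ)
    (R : Matrix κ κ ℝ) (F : Matrix κ ι ℝ) (P : Matrix ι ι ℝ) : Prop where
  posSemidef : P.PosSemidef
  decay : ∀ x, 2 * (x ⬝ᵥ (P *ᵥ ((A - B * F) *ᵥ x))) = -runningCost Q R x (-(F *ᵥ x))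

theorem IsLyapunovMatrix.exists_isFeedbackCost {W : Matrix ι ι ℝ}
    (hW : IsLyapunovMatrix (A - B * F) W) (hQ : Q.PosSemidef) (hR : R.PosSemidef) :
    ∃ P, IsFeedbackCost A B Q R F P := by
  have hcost : (-(Q + Fᵀ * R * F)).IsHermitian :=
    (hQ.isHermitian.add (by simpa using (hR.conjTranspose_mul_mul_same F).isHermitian)).neg
  obtain ⟨P, hP, heq⟩ := hW.exists_lyapunov_eq hcost
  have hdecay : ∀ x, 2 * (x ⬝ᵥ (P *ᵥ ((A - B * F) *ᵥ x))) = -runningCost Q R x (-(F *ᵥ x)) :=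
    fun x => by
      rw [← dotProduct_lyapunov_mulVec hP, heq, neg_mulVec, dotProduct_neg, runningCost_feedback]
  exact ⟨P, hW.posSemidef hP fun x => by
    linarith [hdecay x, runningCost_nonneg hQ hR x (-(F *ᵥ x))], hdecay⟩

/-- Detectability as dissipativity, with the storage function `xᵀ V x`. -/
theorem IsLyapunovMatrix.exists_storage [Fintype γ] {C : Matrix γ ι ℝ} {L : Matrix ι γ ℝ}
    {W : Matrix ι ι ℝ} (hW : IsLyapunovMatrix (A - L * C) W) (B : Matrix ι κ ℝ)
    (hR : R.PosDef) : ∃ V : Matrix ι ι ℝ, V.PosDef ∧ ∃ c : ℝ, 0 ≤ c ∧ ∀ x u,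
      x ⬝ᵥ (V *ᵥ (A *ᵥ x + B *ᵥ u)) ≤ c * runningCost (Cᵀ * C) R x u - x ⬝ᵥ x := by
  obtain ⟨a, ha, hoffset⟩ := exists_young_dotProduct_mulVec (W * L)
  obtain ⟨b, hb, hinput⟩ := exists_young_dotProduct_mulVec (W * B)
  obtain ⟨r, hr, hRr⟩ := exists_dotProduct_self_le_mul_quadratic hR
  refine ⟨(2 : ℝ) • W, hW.posDef.smul two_pos, 2 * (a + b * r), by positivity, fun x u => ?_⟩
  have hsplit : A *ᵥ x + B *ᵥ u = (A - L * C) *ᵥ x + L *ᵥ (C *ᵥ x) + B *ᵥ u := by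
    rw [sub_mulVec, mulVec_mulVec, sub_add_cancel]
  have hoffset := hoffset x (C *ᵥ x)
  have hinput := hinput x u
  have hRu := mul_le_mul_of_nonneg_left (hRr u) hb
  have huR := mul_nonneg ha (quadratic_nonneg hR.posSemidef u)
  have hCx := mul_nonneg (mul_nonneg hb hr) (dotProduct_self_nonneg (C *ᵥ x))
  rw [runningCost, dotProduct_transpose_mul_self_mulVec, hsplit, smul_mulVec, dotProduct_smul,
    mulVec_add, mulVec_add, dotProduct_add, dotProduct_add, smul_eq_mul]
  rw [← mulVec_mulVec] at hoffset hinput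
  linarith [hW.decay x]

variable [DecidableEq κ]

/-- The left-hand side of the algebraic Riccati equation. -/
noncomputable def riccatiResidual (A : Matrix ι ι ℝ) (B : Matrix ι κ ℝ) (Q : Matrix ι ι ℝ)
    (R : Matrix κ κ ℝ) (P : Matrix ι ι ℝ) : Matrix ι ι ℝ :=
  Aᵀ * P + P * A - P * B * R⁻¹ * Bᵀ * P + Q

/-- The gain `R⁻¹ Bᵀ P` of the feedback `u = -K x` that `P` defines. -/
noncomputable def riccatiGain (B : Matrix ι κ ℝ) (R : Matrix κ κ ℝ) (P : Matrix ι ι ℝ) :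
    Matrix κ ι ℝ :=
  R⁻¹ * Bᵀ * P

theorem isHermitian_riccatiResidual (hQ : Q.IsHermitian) (hR : R.IsHermitian)
    (hP : P.IsHermitian) : (riccatiResidual A B Q R P).IsHermitian := by
  have hquad : (P * B * R⁻¹ * Bᵀ * P).IsHermitian := by
    have := isHermitian_mul_mul_conjTranspose (P * B) hR.inv
    rwa [conjTranspose_mul, hP.eq, conjTranspose_eq_transpose_of_trivial,
      ← Matrix.mul_assoc] at this
  exact ((isHermitian_lyapunov hP A).sub hquad).add hQ

/-- Completion of squares: the Riccati gain minimizes the sum of the running cost and the growth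
of `xᵀ P x`, and the Riccati residual is the minimum. -/
theorem runningCost_add_growth_eq (hR : R.PosDef) (hP : P.IsHermitian) (x : ι → ℝ) (u : κ → ℝ) :
    runningCost Q R x u + 2 * (x ⬝ᵥ (P *ᵥ (A *ᵥ x + B *ᵥ u))) =
      (u + riccatiGain B R P *ᵥ x) ⬝ᵥ (R *ᵥ (u + riccatiGain B R P *ᵥ x)) +
        x ⬝ᵥ (riccatiResidual A B Q R P *ᵥ x) := by
  set K := riccatiGain B R P with hK
  have hRK : R *ᵥ (K *ᵥ x) = Bᵀ *ᵥ (P *ᵥ x) := by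
    rw [mulVec_mulVec, hK, riccatiGain, Matrix.mul_assoc, mulVec_mulVec,
      mul_nonsing_inv_cancel_left _ _ ((isUnit_iff_isUnit_det R).1 hR.isUnit)]
  have hinput : ∀ v, x ⬝ᵥ (P *ᵥ (B *ᵥ v)) = v ⬝ᵥ (R *ᵥ (K *ᵥ x)) := fun v => by
    rw [hRK, dotProduct_transpose_mulVec, dotProduct_mulVec_comm_of_isHermitian hP,
      dotProduct_comm]
  have hresidual : x ⬝ᵥ (riccatiResidual A B Q R P *ᵥ x) =
      2 * (x ⬝ᵥ (P *ᵥ (A *ᵥ x))) - (K *ᵥ x) ⬝ᵥ (R *ᵥ (K *ᵥ x)) + x ⬝ᵥ (Q *ᵥ x) := by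
    rw [riccatiResidual, add_mulVec, sub_mulVec, dotProduct_add, dotProduct_sub,
      dotProduct_lyapunov_mulVec hP, ← hinput, hK, riccatiGain]
    simp only [mulVec_mulVec, Matrix.mul_assoc]
  have hcross := dotProduct_mulVec_comm_of_isHermitian hR.isHermitian (K *ᵥ x) u
  rw [hresidual, runningCost]
  simp only [mulVec_add, dotProduct_add, add_dotProduct, hinput, hcross]
  ring

theorem runningCost_add_growth_riccatiGain (hR : R.PosDef) (hP : P.IsHermitian) (x : ι → ℝ) :
    runningCost Q R x (-(riccatiGain B R P *ᵥ x)) +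
      2 * (x ⬝ᵥ (P *ᵥ ((A - B * riccatiGain B R P) *ᵥ x))) =
        x ⬝ᵥ (riccatiResidual A B Q R P *ᵥ x) := by
  rw [sub_mul_mulVec, runningCost_add_growth_eq hR hP, neg_add_cancel, zero_dotProduct, zero_add]

theorem IsFeedbackCost.riccatiResidual_nonpos (hP : IsFeedbackCost A B Q R F P)
    (hQ : Q.IsHermitian) (hR : R.PosDef) : riccatiResidual A B Q R P ≤ 0 := by
  refine (nonpos_iff_quadratic_nonpos
    (isHermitian_riccatiResidual hQ hR.isHermitian hP.posSemidef.isHermitian)).2 fun x => ?_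
  have hsquare := runningCost_add_growth_eq (A := A) (B := B) (Q := Q) hR
    hP.posSemidef.isHermitian x (-(F *ᵥ x))
  rw [← sub_mul_mulVec, hP.decay, add_neg_cancel] at hsquare
  linarith [quadratic_nonneg hR.posSemidef (-(F *ᵥ x) + riccatiGain B R P *ᵥ x)]

/-- One step of policy iteration: `P'` is the cost matrix of the Riccati gain of `P`. -/
theorem exists_le_of_riccatiResidual_nonpos {W : Matrix ι ι ℝ}
    (hW : IsLyapunovMatrix (A - B * riccatiGain B R P) W) (hQ : Q.PosSemidef) (hR : R.PosDef)
    (hP : P.IsHermitian) (hres : riccatiResidual A B Q R P ≤ 0) :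
    ∃ P', P'.PosSemidef ∧ P' ≤ P ∧ riccatiResidual A B Q R P' ≤ 0 ∧
      (P' = P → riccatiResidual A B Q R P = 0) := by
  obtain ⟨P', hP'⟩ := hW.exists_isFeedbackCost hQ hR.posSemidef
  have hherm := isHermitian_riccatiResidual (A := A) (B := B) hQ.isHermitian hR.isHermitian hP
  have hgrowth := runningCost_add_growth_riccatiGain (A := A) (B := B) (Q := Q) hR hP
  refine ⟨P', hP'.posSemidef, hW.posSemidef (hP.sub hP'.posSemidef.isHermitian) fun x => ?_,
    hP'.riccatiResidual_nonpos hQ.isHermitian hR, fun heq => ?_⟩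
  · have hresx := (nonpos_iff_quadratic_nonpos hherm).1 hres x
    rw [sub_mulVec, dotProduct_sub]
    linarith [hP'.decay x, hgrowth x]
  · refine eq_zero_of_quadratic_eq_zero hherm fun x => ?_
    have hdecay := hP'.decay x
    rw [heq] at hdecay
    rw [← hgrowth, hdecay, add_neg_cancel]

theorem exists_isLyapunovMatrix_closedLoop [Fintype γ] {C : Matrix γ ι ℝ} {L : Matrix ι γ ℝ}
    {W : Matrix ι ι ℝ} (hW : IsLyapunovMatrix (A - L * C) W) (hR : R.PosDef)
    (hP : P.PosSemidef) (hres : riccatiResidual A B (Cᵀ * C) R P ≤ 0) :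
    ∃ V, IsLyapunovMatrix (A - B * riccatiGain B R P) V := by
  obtain ⟨V, hV, c, hc, hstorage⟩ := hW.exists_storage B hR
  refine ⟨V + (2 * c) • P, hV.add_posSemidef (hP.smul (by positivity)), fun x => ?_⟩
  have hCC := posSemidef_transpose_mul_self C
  have hresx := (nonpos_iff_quadratic_nonpos (isHermitian_riccatiResidual (A := A) (B := B)
    hCC.isHermitian hR.isHermitian hP.isHermitian)).1 hres x
  have hVx := hstorage x (-(riccatiGain B R P *ᵥ x))
  have hPx := mul_le_mul_of_nonneg_left
    ((runningCost_add_growth_riccatiGain hR hP.isHermitian x).trans_le hresx) hc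
  rw [← sub_mul_mulVec] at hVx
  rw [add_mulVec, dotProduct_add, smul_mulVec, dotProduct_smul, smul_eq_mul]
  linarith

theorem continuous_riccatiResidual (A : Matrix ι ι ℝ) (B : Matrix ι κ ℝ) (Q : Matrix ι ι ℝ)
    (R : Matrix κ κ ℝ) : Continuous (riccatiResidual A B Q R) := by
  unfold riccatiResidual
  fun_prop

theorem exists_posSemidef_riccatiResidual_eq_zero [Fintype γ] {C : Matrix γ ι ℝ}
    {L : Matrix ι γ ℝ} {V W : Matrix ι ι ℝ} (hV : IsLyapunovMatrix (A - B * F) V)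
    (hW : IsLyapunovMatrix (A - L * C) W) (hR : R.PosDef) :
    ∃ P, P.PosSemidef ∧ riccatiResidual A B (Cᵀ * C) R P = 0 := by
  have hCC := posSemidef_transpose_mul_self C
  obtain ⟨P₀, hP₀⟩ := hV.exists_isFeedbackCost hCC hR.posSemidef
  have hclosed : IsClosed {P | riccatiResidual A B (Cᵀ * C) R P ≤ 0} :=
    isClosed_setOf_posSemidef.preimage
      (continuous_const.sub (continuous_riccatiResidual A B (Cᵀ * C) R))
  obtain ⟨P, ⟨⟨hP, hPtr⟩, hPres⟩, hmin⟩ :=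
    ((isCompact_setOf_posSemidef_and_trace_le P₀.trace).inter_right hclosed).exists_isMinOn
      ⟨P₀, ⟨hP₀.posSemidef, le_rfl⟩, hP₀.riccatiResidual_nonpos hCC.isHermitian hR⟩
      continuous_id.matrix_trace.continuousOn
  obtain ⟨U, hU⟩ := exists_isLyapunovMatrix_closedLoop hW hR hP hPres
  obtain ⟨P', hP', hle, hP'res, heq⟩ :=
    exists_le_of_riccatiResidual_nonpos hU hCC hR hP.isHermitian hPres
  have hP'mem := And.intro (And.intro hP' ((trace_mono hle).trans hPtr)) hP'res
  exact ⟨P, hP, heq (eq_of_le_of_trace_le hle (isMinOn_iff.1 hmin P' hP'mem))⟩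

theorem IsLyapunovMatrix.eventually_two_smul {M₀ W : Matrix ι ι ℝ}
    (hW : IsLyapunovMatrix M₀ W) : ∀ᶠ M in 𝓝 M₀, IsLyapunovMatrix M ((2 : ℝ) • W) := by
  have hcont : Continuous fun M : Matrix ι ι ℝ => ∑ i, ∑ j, |(W * (M - M₀)) i j| :=
    continuous_finsetSum _ fun i _ => continuous_finsetSum _ fun j _ =>
      (Continuous.matrix_elem (by fun_prop) i j).abs
  filter_upwards [(hcont.tendsto M₀).eventually_lt_const (u := 1 / 2) (by simp)] with M hM
  refine ⟨hW.posDef.smul two_pos, fun x => ?_⟩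
  have hpert := (le_abs_self _).trans (abs_quadratic_le (W * (M - M₀)) x)
  have hsmall := mul_le_mul_of_nonneg_right hM.le (dotProduct_self_nonneg x)
  rw [← mulVec_mulVec, sub_mulVec, mulVec_sub, dotProduct_sub] at hpert
  rw [smul_mulVec, dotProduct_smul, smul_eq_mul]
  linarith [hW.decay x]

theorem IsLyapunovMatrix.le_smul_of_riccatiResidual_eq_zero {W : Matrix ι ι ℝ} {c : ℝ}
    (hW : IsLyapunovMatrix (A - B * F) W) (hR : R.PosDef) (hP : P.IsHermitian)
    (hres : riccatiResidual A B Q R P = 0) (hc : 0 ≤ c)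
    (hcost : ∀ x, runningCost Q R x (-(F *ᵥ x)) ≤ c * (x ⬝ᵥ x)) : P ≤ c • W := by
  refine hW.posSemidef ((hW.posDef.isHermitian.smul (.all c)).sub hP) fun x => ?_
  have hgrowth := runningCost_add_growth_eq (A := A) (B := B) (Q := Q) hR hP x (-(F *ᵥ x))
  rw [← sub_mul_mulVec, hres, zero_mulVec, dotProduct_zero, add_zero] at hgrowth
  have hdecay := mul_le_mul_of_nonneg_left (hW.decay x) hc
  have hcx := mul_nonneg hc (dotProduct_self_nonneg x)
  have hsquare := quadratic_nonneg hR.posSemidef (-(F *ᵥ x) + riccatiGain B R P *ᵥ x)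
  rw [sub_mulVec, dotProduct_sub, smul_mulVec, dotProduct_smul, smul_eq_mul]
  linarith [hcost x]

theorem eventually_trace_le_of_riccatiResidual_eq_zero {A₀ W : Matrix ι ι ℝ}
    (hW : IsLyapunovMatrix (A₀ - B * F) W) (Q : Matrix ι ι ℝ) (hR : R.PosDef) :
    ∃ c : ℝ, ∀ᶠ A in 𝓝 A₀, ∀ P : Matrix ι ι ℝ, P.IsHermitian →
      riccatiResidual A B Q R P = 0 → P.trace ≤ c := by
  obtain ⟨c, hc, hcost⟩ := exists_quadratic_le_mul_dotProduct_self (Q + Fᵀ * R * F)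
  have hclosedLoop : Tendsto (fun A => A - B * F) (𝓝 A₀) (𝓝 (A₀ - B * F)) :=
    tendsto_id.sub_const _
  refine ⟨(c • (2 : ℝ) • W).trace, (hclosedLoop.eventually hW.eventually_two_smul).mono
    fun A hA P hP hres => trace_mono ?_⟩
  exact hA.le_smul_of_riccatiResidual_eq_zero hR hP hres hc
    fun x => by simpa only [runningCost_feedback] using hcost x

end Riccati

section Primitives

variable {E E' : Type*} [NormedAddCommGroup E] [NormedSpace ℝ E] [NormedAddCommGroup E']
  [NormedSpace ℝ E'] {ι : Type*} [Fintype ι] {a b : ℝ}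

/-- `F` is an indefinite integral of `f` on the interval with endpoints `a` and `b`; the value of
`F` at `a` is arbitrary. -/
structure IsPrimitiveOn (f F : ℝ → E) (a b : ℝ) : Prop where
  intervalIntegrable : IntervalIntegrable f volume a b
  eq_add_integral : ∀ t ∈ uIcc a b, F t = F a + ∫ s in a..t, f s

namespace IsPrimitiveOn

theorem continuousOn {f F : ℝ → E} (h : IsPrimitiveOn f F a b) : ContinuousOn F (uIcc a b) :=
  (continuousOn_const.add (intervalIntegral.continuousOn_primitive_interval'
    h.intervalIntegrable left_mem_uIcc)).congr h.eq_add_integral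

theorem clm_comp [CompleteSpace E] [CompleteSpace E'] {f F : ℝ → E} (h : IsPrimitiveOn f F a b)
    (L : E →L[ℝ] E') : IsPrimitiveOn (fun t => L (f t)) (fun t => L (F t)) a b where
  intervalIntegrable :=
    ⟨L.integrable_comp h.intervalIntegrable.1, L.integrable_comp h.intervalIntegrable.2⟩
  eq_add_integral t ht := by
    rw [L.intervalIntegral_comp_comm (h.intervalIntegrable.mono_set (uIcc_subset_uIcc_left ht)),
      ← map_add, ← h.eq_add_integral t ht]

theorem integral_mul_add_mul {f F g G : ℝ → ℝ} (hF : IsPrimitiveOn f F a b)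
    (hG : IsPrimitiveOn g G a b) :
    ∫ t in a..b, (f t * G t + F t * g t) = F b * G b - F a * G a := by
  have absolutelyContinuous {h : ℝ → ℝ} (c : ℝ) (hh : IntervalIntegrable h volume a b) :
      AbsolutelyContinuousOnInterval (fun t => c + ∫ s in a..t, h s) a b :=
    (LipschitzWith.const c).lipschitzOnWith.absolutelyContinuousOnInterval.add
      (hh.absolutelyContinuousOnInterval_intervalIntegral left_mem_uIcc)
  have hparts := (absolutelyContinuous (F a) hF.intervalIntegrable).integral_deriv_mul_eq_sub
    (absolutelyContinuous (G a) hG.intervalIntegrable)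
  simp only [← hF.eq_add_integral b right_mem_uIcc, ← hG.eq_add_integral b right_mem_uIcc,
    intervalIntegral.integral_same, add_zero] at hparts
  rw [← hparts]
  apply intervalIntegral.integral_congr_ae
  filter_upwards [hF.intervalIntegrable.ae_hasDerivAt_integral,
    hG.intervalIntegrable.ae_hasDerivAt_integral] with t hf hg ht
  have ht' := uIoc_subset_uIcc ht
  rw [((hf ht' a left_mem_uIcc).const_add (F a)).deriv,
    ((hg ht' a left_mem_uIcc).const_add (G a)).deriv, hF.eq_add_integral t ht',
    hG.eq_add_integral t ht']

theorem apply {f F : ℝ → ι → ℝ} (h : IsPrimitiveOn f F a b) (i : ι) :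
    IsPrimitiveOn (fun t => f t i) (fun t => F t i) a b :=
  h.clm_comp (ContinuousLinearMap.proj (R := ℝ) i)

theorem mulVec {κ : Type*} [Fintype κ] {f F : ℝ → ι → ℝ} (h : IsPrimitiveOn f F a b)
    (M : Matrix κ ι ℝ) : IsPrimitiveOn (fun t => M *ᵥ f t) (fun t => M *ᵥ F t) a b :=
  h.clm_comp (LinearMap.toContinuousLinearMap M.mulVecLin)

variable {f F g G : ℝ → ι → ℝ}

theorem intervalIntegrable_dotProduct (hF : IsPrimitiveOn f F a b) (hG : IsPrimitiveOn g G a b) :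
    IntervalIntegrable (fun t => F t ⬝ᵥ g t) volume a b := by
  have hsum := IntervalIntegrable.sum Finset.univ fun i _ =>
    (hG.apply i).intervalIntegrable.continuousOn_mul (hF.apply i).continuousOn
  exact hsum.congr fun t _ => by simp [dotProduct]

theorem integral_dotProduct_add_dotProduct (hF : IsPrimitiveOn f F a b)
    (hG : IsPrimitiveOn g G a b) :
    ∫ t in a..b, (f t ⬝ᵥ G t + F t ⬝ᵥ g t) = F b ⬝ᵥ G b - F a ⬝ᵥ G a := by
  simp only [dotProduct, ← Finset.sum_add_distrib, ← Finset.sum_sub_distrib]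
  rw [intervalIntegral.integral_finsetSum fun i _ =>
    ((hF.apply i).intervalIntegrable.mul_continuousOn (hG.apply i).continuousOn).add
      ((hG.apply i).intervalIntegrable.continuousOn_mul (hF.apply i).continuousOn)]
  exact Finset.sum_congr rfl fun i _ => (hF.apply i).integral_mul_add_mul (hG.apply i)

theorem integral_two_mul_quadratic (hF : IsPrimitiveOn f F a b) {P : Matrix ι ι ℝ}
    (hP : P.IsHermitian) :
    ∫ t in a..b, 2 * (F t ⬝ᵥ (P *ᵥ f t)) = F b ⬝ᵥ (P *ᵥ F b) - F a ⬝ᵥ (P *ᵥ F a) := by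
  rw [← hF.integral_dotProduct_add_dotProduct (hF.mulVec P)]
  simp only [two_mul, dotProduct_mulVec_comm_of_isHermitian hP (f _)]

end IsPrimitiveOn

end Primitives

section Trajectories

variable {n m : ℕ} {A P Q : Matrix (Fin n) (Fin n) ℝ} {B : Matrix (Fin n) (Fin m) ℝ}
  {R : Matrix (Fin m) (Fin m) ℝ} {x₀ : Fin n → ℝ} {y : ℝ → Fin n → ℝ} {v : ℝ → Fin m → ℝ}
  {T : ℝ}

namespace IsTrajectory

theorem apply_zero (h : IsTrajectory A B x₀ y v) : y 0 = x₀ := by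
  simpa using h.integral_eq 0 le_rfl

theorem isPrimitiveOn (h : IsTrajectory A B x₀ y v) (hT : 0 ≤ T) :
    IsPrimitiveOn (fun t => A *ᵥ y t + B *ᵥ v t) y 0 T where
  intervalIntegrable := by
    have hy : ContinuousOn (fun t => A *ᵥ y t) (uIcc 0 T) :=
      (by fun_prop : Continuous (A *ᵥ ·)).comp_continuousOn
        (h.continuousOn.mono (uIcc_of_le hT ▸ Icc_subset_Ici_self))
    have hv : IntervalIntegrable (fun t => B *ᵥ v t) volume 0 T :=
      let L := LinearMap.toContinuousLinearMap B.mulVecLin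
      ⟨L.integrable_comp (h.locallyIntegrable T hT).1,
        L.integrable_comp (h.locallyIntegrable T hT).2⟩
    exact hy.intervalIntegrable.add hv
  eq_add_integral t ht := by
    rw [h.apply_zero]
    exact h.integral_eq t (uIcc_of_le hT ▸ ht).1

theorem intervalIntegrable_growth (h : IsTrajectory A B x₀ y v) (P : Matrix (Fin n) (Fin n) ℝ)
    (hT : 0 ≤ T) :
    IntervalIntegrable (fun t => 2 * (y t ⬝ᵥ (P *ᵥ (A *ᵥ y t + B *ᵥ v t)))) volume 0 T :=
  ((h.isPrimitiveOn hT).intervalIntegrable_dotProduct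
    ((h.isPrimitiveOn hT).mulVec P)).const_mul 2

theorem integral_growth (h : IsTrajectory A B x₀ y v) (hP : P.IsHermitian) (hT : 0 ≤ T) :
    ∫ t in (0 : ℝ)..T, 2 * (y t ⬝ᵥ (P *ᵥ (A *ᵥ y t + B *ᵥ v t))) =
      y T ⬝ᵥ (P *ᵥ y T) - x₀ ⬝ᵥ (P *ᵥ x₀) := by
  rw [(h.isPrimitiveOn hT).integral_two_mul_quadratic hP, h.apply_zero]

theorem integrableOn_runningCost (h : IsTrajectory A B x₀ y v) (hQ : Q.PosSemidef)
    (hR : R.PosSemidef) (hfin : lqrCost Q R y v ≠ ⊤) (hT : 0 ≤ T) :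
    IntegrableOn (fun t => runningCost Q R (y t) (v t)) (Ioc 0 T) := by
  refine ⟨?_, ?_⟩
  · have hy : AEStronglyMeasurable y (volume.restrict (Ioc 0 T)) :=
      (h.continuousOn.mono fun t ht => ht.1.le).aestronglyMeasurable measurableSet_Ioc
    have hv := (h.locallyIntegrable T hT).1.aestronglyMeasurable
    have hcont : Continuous fun z : (Fin n → ℝ) × (Fin m → ℝ) => runningCost Q R z.1 z.2 := by
      unfold runningCost
      fun_prop
    exact hcont.comp_aestronglyMeasurable (hy.prodMk hv)
  · rw [hasFiniteIntegral_iff_ofReal (.of_forall fun t => runningCost_nonneg hQ hR _ _)]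
    exact (lintegral_mono_set Ioc_subset_Ioi_self).trans_lt (lt_top_iff_ne_top.2 hfin)

theorem intervalIntegrable_runningCost (h : IsTrajectory A B x₀ y v) (hQ : Q.PosSemidef)
    (hR : R.PosSemidef) (hfin : lqrCost Q R y v ≠ ⊤) (hT : 0 ≤ T) :
    IntervalIntegrable (fun t => runningCost Q R (y t) (v t)) volume 0 T :=
  (intervalIntegrable_iff_integrableOn_Ioc_of_le hT).2 (h.integrableOn_runningCost hQ hR hfin hT)

theorem integral_runningCost_le (h : IsTrajectory A B x₀ y v) (hQ : Q.PosSemidef)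
    (hR : R.PosSemidef) (hfin : lqrCost Q R y v ≠ ⊤) (hT : 0 ≤ T) :
    ∫ t in (0 : ℝ)..T, runningCost Q R (y t) (v t) ≤ (lqrCost Q R y v).toReal := by
  rw [intervalIntegral.integral_of_le hT, ← ENNReal.ofReal_le_iff_le_toReal hfin,
    ofReal_integral_eq_lintegral_ofReal (h.integrableOn_runningCost hQ hR hfin hT)
      (.of_forall fun t => runningCost_nonneg hQ hR _ _)]
  exact lintegral_mono_set Ioc_subset_Ioi_self

theorem intervalIntegrable_dotProduct_self (h : IsTrajectory A B x₀ y v) {S : ℝ} (hS : 0 ≤ S)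
    (hT : 0 ≤ T) : IntervalIntegrable (fun t => y t ⬝ᵥ y t) volume S T :=
  ((by fun_prop : Continuous fun x : Fin n → ℝ => x ⬝ᵥ x).comp_continuousOn
    (h.continuousOn.mono fun _ ht => (le_min hS hT).trans ht.1)).intervalIntegrable

end IsTrajectory

end Trajectories

section Improper

variable {f : ℝ → ℝ} {a D : ℝ}

theorem integrableOn_Ioi_of_intervalIntegral_le (hf : ∀ t, 0 ≤ f t)
    (hint : ∀ b, a ≤ b → IntervalIntegrable f volume a b)
    (hD : ∀ b, a ≤ b → ∫ t in a..b, f t ≤ D) : IntegrableOn f (Ioi a) := by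
  have hb (t : ℝ) : a ≤ max a t := le_max_left a t
  refine integrableOn_Ioi_of_intervalIntegral_norm_bounded D a (fun t => (hint _ (hb t)).1)
    (tendsto_atTop_mono (le_max_right a) tendsto_id) (.of_forall fun t => ?_)
  simpa only [Real.norm_of_nonneg (hf _)] using hD _ (hb t)

theorem lintegral_Ioi_ofReal_le_of_intervalIntegral_le (hf : ∀ t, 0 ≤ f t)
    (hint : ∀ b, a ≤ b → IntervalIntegrable f volume a b)
    (hD : ∀ b, a ≤ b → ∫ t in a..b, f t ≤ D) :
    ∫⁻ t in Ioi a, ENNReal.ofReal (f t) ≤ ENNReal.ofReal D := by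
  have hfa := integrableOn_Ioi_of_intervalIntegral_le hf hint hD
  rw [← ofReal_integral_eq_lintegral_ofReal hfa (.of_forall hf)]
  exact ENNReal.ofReal_le_ofReal (le_of_tendsto
    (intervalIntegral_tendsto_integral_Ioi a hfa tendsto_id)
    ((eventually_ge_atTop a).mono hD))

theorem frequently_lt_of_integrableOn_Ioi (hf : IntegrableOn f (Ioi a)) {ε : ℝ} (hε : 0 < ε) :
    ∃ᶠ t in atTop, f t < ε := by
  intro hge
  obtain ⟨T, hT⟩ := eventually_atTop.1 hge
  have hconst : IntegrableOn (fun _ => ε) (Ioi (max a T)) := by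
    refine (hf.mono_set (Ioi_subset_Ioi (le_max_left a T))).mono'
      aestronglyMeasurable_const (ae_restrict_of_forall_mem measurableSet_Ioi fun t ht => ?_)
    rw [Real.norm_of_nonneg hε.le]
    exact not_lt.1 (hT t ((le_max_right a T).trans ht.le))
  simp [hε.ne', integrableOn_const_iff] at hconst

end Improper

section Optimality

variable {n m q : ℕ} {A P Q : Matrix (Fin n) (Fin n) ℝ} {B : Matrix (Fin n) (Fin m) ℝ}
  {C : Matrix (Fin q) (Fin n) ℝ} {R : Matrix (Fin m) (Fin m) ℝ} {x₀ : Fin n → ℝ}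
  {y : ℝ → Fin n → ℝ} {v : ℝ → Fin m → ℝ} {T : ℝ}

namespace IsTrajectory

theorem integrableOn_dotProduct_self (h : IsTrajectory A B x₀ y v) (hdet : IsDetectable A C)
    (hR : R.PosDef) (hfin : lqrCost (Cᵀ * C) R y v ≠ ⊤) :
    IntegrableOn (fun t => y t ⬝ᵥ y t) (Ioi 0) := by
  obtain ⟨L, hL⟩ := hdet
  obtain ⟨W, hW⟩ := hL.exists_isLyapunovMatrix
  obtain ⟨V, hV, c, hc, hstorage⟩ := hW.exists_storage B hR
  have hCC := posSemidef_transpose_mul_self C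
  set J := (lqrCost (Cᵀ * C) R y v).toReal
  refine integrableOn_Ioi_of_intervalIntegral_le (fun t => dotProduct_self_nonneg _)
    (fun T hT => h.intervalIntegrable_dotProduct_self le_rfl hT)
    (D := c * J + x₀ ⬝ᵥ (V *ᵥ x₀) / 2) fun T hT => ?_
  have hy := h.intervalIntegrable_dotProduct_self le_rfl hT
  have hcost := (h.intervalIntegrable_runningCost hCC hR.posSemidef hfin hT).const_mul c
  have hdissipation := intervalIntegral.integral_mono_on hT (h.intervalIntegrable_growth V hT)
    ((hcost.sub hy).const_mul 2) fun t _ => mul_le_mul_of_nonneg_left (hstorage _ _) two_pos.le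
  rw [h.integral_growth hV.isHermitian hT, intervalIntegral.integral_const_mul,
    intervalIntegral.integral_sub hcost hy, intervalIntegral.integral_const_mul] at hdissipation
  have hJ := mul_le_mul_of_nonneg_left
    (h.integral_runningCost_le hCC hR.posSemidef hfin hT) hc
  linarith [quadratic_nonneg hV.posSemidef (y T)]

theorem frequently_quadratic_lt (h : IsTrajectory A B x₀ y v) (hdet : IsDetectable A C)
    (hR : R.PosDef) (hfin : lqrCost (Cᵀ * C) R y v ≠ ⊤) (P : Matrix (Fin n) (Fin n) ℝ) {ε : ℝ}
    (hε : 0 < ε) : ∃ᶠ t in atTop, y t ⬝ᵥ (P *ᵥ y t) < ε := by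
  obtain ⟨c, -, hc⟩ := exists_quadratic_le_mul_dotProduct_self P
  exact (frequently_lt_of_integrableOn_Ioi
    ((h.integrableOn_dotProduct_self hdet hR hfin).const_mul c) hε).mono
      fun t ht => (hc (y t)).trans_lt ht

end IsTrajectory

/-- The excess running cost `(u + K x)ᵀ R (u + K x)` of an input `u` over the feedback `-K x`
given by the Riccati gain `K` of `P`. -/
noncomputable def excessCost (B : Matrix (Fin n) (Fin m) ℝ) (R : Matrix (Fin m) (Fin m) ℝ)
    (P : Matrix (Fin n) (Fin n) ℝ) (x : Fin n → ℝ) (u : Fin m → ℝ) : ℝ :=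
  (u + riccatiGain B R P *ᵥ x) ⬝ᵥ (R *ᵥ (u + riccatiGain B R P *ᵥ x))

theorem excessCost_nonneg (hR : R.PosSemidef) (B : Matrix (Fin n) (Fin m) ℝ)
    (P : Matrix (Fin n) (Fin n) ℝ) (x : Fin n → ℝ) (u : Fin m → ℝ) : 0 ≤ excessCost B R P x u :=
  quadratic_nonneg hR _

theorem SolvesCARE.excessCost_eq (hcare : SolvesCARE A B Q R P) (hR : R.PosDef)
    (hP : P.IsHermitian) (x : Fin n → ℝ) (u : Fin m → ℝ) :
    excessCost B R P x u = runningCost Q R x u + 2 * (x ⬝ᵥ (P *ᵥ (A *ᵥ x + B *ᵥ u))) := by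
  have hres : riccatiResidual A B Q R P = 0 := hcare
  rw [runningCost_add_growth_eq hR hP, hres, zero_mulVec, dotProduct_zero, add_zero, excessCost]

theorem SolvesCARE.runningCost_closedLoop_eq (hcare : SolvesCARE A B Q R P) (hR : R.PosDef)
    (hP : P.IsHermitian) (x : Fin n → ℝ) :
    runningCost Q R x (-(riccatiGain B R P *ᵥ x)) =
      -(2 * (x ⬝ᵥ (P *ᵥ (A *ᵥ x + B *ᵥ (-(riccatiGain B R P *ᵥ x)))))) := by
  rw [eq_neg_iff_add_eq_zero, ← hcare.excessCost_eq hR hP, excessCost, neg_add_cancel,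
    zero_dotProduct]

namespace IsTrajectory

theorem intervalIntegrable_excessCost (h : IsTrajectory A B x₀ y v)
    (hcare : SolvesCARE A B Q R P) (hQ : Q.PosSemidef) (hR : R.PosDef) (hP : P.IsHermitian)
    (hfin : lqrCost Q R y v ≠ ⊤) (hT : 0 ≤ T) :
    IntervalIntegrable (fun t => excessCost B R P (y t) (v t)) volume 0 T := by
  simp only [hcare.excessCost_eq hR hP]
  exact (h.intervalIntegrable_runningCost hQ hR.posSemidef hfin hT).add
    (h.intervalIntegrable_growth P hT)

theorem value_add_integral_excessCost_eq (h : IsTrajectory A B x₀ y v)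
    (hcare : SolvesCARE A B Q R P) (hQ : Q.PosSemidef) (hR : R.PosDef) (hP : P.IsHermitian)
    (hfin : lqrCost Q R y v ≠ ⊤) (hT : 0 ≤ T) :
    x₀ ⬝ᵥ (P *ᵥ x₀) + ∫ t in (0 : ℝ)..T, excessCost B R P (y t) (v t) =
      (∫ t in (0 : ℝ)..T, runningCost Q R (y t) (v t)) + y T ⬝ᵥ (P *ᵥ y T) := by
  simp only [hcare.excessCost_eq hR hP]
  rw [intervalIntegral.integral_add (h.intervalIntegrable_runningCost hQ hR.posSemidef hfin hT)
    (h.intervalIntegrable_growth P hT), h.integral_growth hP hT]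
  ring

/-- A finite cost forces the state, hence `yᵀ P y`, to come arbitrarily close to zero. -/
theorem value_add_integral_excessCost_le (h : IsTrajectory A B x₀ y v)
    (hcare : SolvesCARE A B (Cᵀ * C) R P) (hdet : IsDetectable A C) (hR : R.PosDef)
    (hP : P.IsHermitian) (hfin : lqrCost (Cᵀ * C) R y v ≠ ⊤) (hT : 0 ≤ T) :
    x₀ ⬝ᵥ (P *ᵥ x₀) + ∫ t in (0 : ℝ)..T, excessCost B R P (y t) (v t) ≤
      (lqrCost (Cᵀ * C) R y v).toReal := by
  have hCC := posSemidef_transpose_mul_self C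
  refine le_of_forall_pos_le_add fun ε hε => ?_
  obtain ⟨S, hsmall, hTS⟩ := ((h.frequently_quadratic_lt hdet hR hfin P hε).and_eventually
    (eventually_ge_atTop T)).exists
  have hS := hT.trans hTS
  have hmono : ∫ t in (0 : ℝ)..T, excessCost B R P (y t) (v t) ≤
      ∫ t in (0 : ℝ)..S, excessCost B R P (y t) (v t) :=
    intervalIntegral.integral_mono_interval le_rfl hT hTS
      (.of_forall fun t => excessCost_nonneg hR.posSemidef B P _ _)
      (h.intervalIntegrable_excessCost hcare hCC hR hP hfin hS)
  linarith [h.value_add_integral_excessCost_eq hcare hCC hR hP hfin hS,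
    h.integral_runningCost_le hCC hR.posSemidef hfin hS]

theorem lqrCost_closedLoop_le (h : IsTrajectory A B x₀ y fun t => -(riccatiGain B R P *ᵥ y t))
    (hcare : SolvesCARE A B Q R P) (hQ : Q.PosSemidef) (hR : R.PosDef) (hP : P.PosSemidef) :
    lqrCost Q R y (fun t => -(riccatiGain B R P *ᵥ y t)) ≤ ENNReal.ofReal (x₀ ⬝ᵥ (P *ᵥ x₀)) := by
  have hrate := hcare.runningCost_closedLoop_eq hR hP.isHermitian
  refine lintegral_Ioi_ofReal_le_of_intervalIntegral_le
    (fun t => runningCost_nonneg hQ hR.posSemidef (y t) _) (fun T hT => ?_) (fun T hT => ?_)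
  · exact (h.intervalIntegrable_growth P hT).neg.congr fun t _ => (hrate (y t)).symm
  · change ∫ t in (0 : ℝ)..T, runningCost Q R (y t) (-(riccatiGain B R P *ᵥ y t)) ≤ _
    simp only [hrate]
    rw [intervalIntegral.integral_neg, h.integral_growth hP.isHermitian hT]
    linarith [quadratic_nonneg hP (y T)]

end IsTrajectory

theorem exists_isTrajectory_closedLoop (A : Matrix (Fin n) (Fin n) ℝ)
    (B : Matrix (Fin n) (Fin m) ℝ) (K : Matrix (Fin m) (Fin n) ℝ) (x₀ : Fin n → ℝ) :
    ∃ x : ℝ → Fin n → ℝ, IsTrajectory A B x₀ x (fun t => -(K *ᵥ x t)) := by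
  set M : (Fin n → ℝ) →L[ℝ] (Fin n → ℝ) :=
    LinearMap.toContinuousLinearMap (A - B * K).mulVecLin
  set x : ℝ → Fin n → ℝ := fun t => NormedSpace.exp (t • M) x₀ with hx
  have hderiv (t : ℝ) : HasDerivAt x (M (x t)) t :=
    ((hasDerivAt_exp_smul_const' (𝕂 := ℝ) M t).clm_apply (hasDerivAt_const t x₀)).congr_deriv
      (by simp [hx])
  have hcont : Continuous x := continuous_iff_continuousAt.2 fun t => (hderiv t).continuousAt
  refine ⟨x, hcont.continuousOn, fun T _ => Continuous.intervalIntegrable (by fun_prop) _ _,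
    fun t _ => ?_⟩
  have hvelocity (s : ℝ) : A *ᵥ x s + B *ᵥ (-(K *ᵥ x s)) = M (x s) :=
    (sub_mul_mulVec A B K (x s)).symm
  simp only [hvelocity]
  rw [intervalIntegral.integral_eq_sub_of_hasDerivAt (fun s _ => hderiv s)
    ((M.continuous.comp hcont).intervalIntegrable _ _)]
  simp [hx]

theorem SolvesCARE.isOptimalGain_riccatiGain (hcare : SolvesCARE A B (Cᵀ * C) R P)
    (hdet : IsDetectable A C) (hR : R.PosDef) (hP : P.PosSemidef) :
    IsOptimalGain A B (Cᵀ * C) R (riccatiGain B R P) := by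
  intro x₀
  obtain ⟨x, hx⟩ := exists_isTrajectory_closedLoop A B (riccatiGain B R P) x₀
  refine ⟨x, hx, fun y v hy =>
    (hx.lqrCost_closedLoop_le hcare (posSemidef_transpose_mul_self C) hR hP).trans ?_⟩
  obtain hfin | hfin := eq_or_ne (lqrCost (Cᵀ * C) R y v) ⊤
  · exact hfin ▸ le_top
  · have hvalue :=
      hy.value_add_integral_excessCost_le hcare hdet hR hP.isHermitian hfin le_rfl
    rw [intervalIntegral.integral_same, add_zero] at hvalue
    exact ENNReal.ofReal_le_of_le_toReal hvalue

/-- An optimal feedback has no excess cost over `[0, 1]`, hence, by continuity, none at time `0`. -/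
theorem IsOptimalGain.excessCost_eq_zero {K : Matrix (Fin m) (Fin n) ℝ}
    (hopt : IsOptimalGain A B (Cᵀ * C) R K) (hcare : SolvesCARE A B (Cᵀ * C) R P)
    (hdet : IsDetectable A C) (hR : R.PosDef) (hP : P.PosSemidef) (x₀ : Fin n → ℝ) :
    excessCost B R P x₀ (-(K *ᵥ x₀)) = 0 := by
  obtain ⟨x, hx, hmin⟩ := hopt x₀
  obtain ⟨z, hz⟩ := exists_isTrajectory_closedLoop A B (riccatiGain B R P) x₀
  have hcost := (hmin z _ hz).trans
    (hz.lqrCost_closedLoop_le hcare (posSemidef_transpose_mul_self C) hR hP)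
  have hfin := ne_top_of_le_ne_top ENNReal.ofReal_ne_top hcost
  have hvalue := hx.value_add_integral_excessCost_le hcare hdet hR hP.isHermitian hfin zero_le_one
  have hcostP := ENNReal.toReal_le_of_le_ofReal (quadratic_nonneg hP x₀) hcost
  have hcont : Continuous fun w => excessCost B R P w (-(K *ᵥ w)) := by
    unfold excessCost
    fun_prop
  rw [← hx.apply_zero]
  by_contra hne
  have hpos := intervalIntegral.integral_pos zero_lt_one
    (hcont.comp_continuousOn (hx.continuousOn.mono Icc_subset_Ici_self))
    (fun t _ => excessCost_nonneg hR.posSemidef B P _ _)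
    ⟨0, left_mem_Icc.2 zero_le_one, (excessCost_nonneg hR.posSemidef B P _ _).lt_of_ne' hne⟩
  simp only [Function.comp_apply] at hpos
  linarith

theorem IsOptimalGain.eq_riccatiGain {K : Matrix (Fin m) (Fin n) ℝ}
    (hopt : IsOptimalGain A B (Cᵀ * C) R K) (hcare : SolvesCARE A B (Cᵀ * C) R P)
    (hdet : IsDetectable A C) (hR : R.PosDef) (hP : P.PosSemidef) : K = riccatiGain B R P := by
  refine ext_of_mulVec_single fun j => neg_add_eq_zero.1 ?_
  by_contra hne
  exact (quadratic_pos hR hne).ne' (hopt.excessCost_eq_zero hcare hdet hR hP _)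

end Optimality

section Observability

theorem mulVec_eq_zero_of_riccatiResidual_eq_zero {ι κ γ : Type*} [Fintype ι] [Fintype κ]
    [DecidableEq κ] [Fintype γ] {A P : Matrix ι ι ℝ} {B : Matrix ι κ ℝ} {C : Matrix γ ι ℝ}
    {R : Matrix κ κ ℝ} (hP : P.IsHermitian) (hres : riccatiResidual A B (Cᵀ * C) R P = 0)
    {x : ι → ℝ} (hx : P *ᵥ x = 0) : C *ᵥ x = 0 ∧ P *ᵥ (A *ᵥ x) = 0 := by
  have hkernel : P *ᵥ (A *ᵥ x) + (Cᵀ * C) *ᵥ x = 0 := by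
    have := congrArg (· *ᵥ x) hres
    simpa only [riccatiResidual, add_mulVec, sub_mulVec, ← mulVec_mulVec, hx, mulVec_zero,
      zero_add, sub_zero, zero_mulVec] using this
  have houtput : C *ᵥ x = 0 := by
    have := congrArg (x ⬝ᵥ ·) hkernel
    rw [dotProduct_add, dotProduct_mulVec_comm_of_isHermitian hP, hx,
      dotProduct_transpose_mul_self_mulVec] at this
    simpa only [dotProduct_zero, zero_add, dotProduct_self_eq_zero] using this
  exact ⟨houtput, by simpa only [← mulVec_mulVec, houtput, mulVec_zero, add_zero] using hkernel⟩

theorem SolvesCARE.posDef_of_isObservable {n m q : ℕ} {A P : Matrix (Fin n) (Fin n) ℝ}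
    {B : Matrix (Fin n) (Fin m) ℝ} {C : Matrix (Fin q) (Fin n) ℝ}
    {R : Matrix (Fin m) (Fin m) ℝ} (hcare : SolvesCARE A B (Cᵀ * C) R P)
    (hobs : IsObservable A C) (hP : P.PosSemidef) : P.PosDef := by
  have hkernel {x : Fin n → ℝ} (hx : P *ᵥ x = 0) :=
    mulVec_eq_zero_of_riccatiResidual_eq_zero hP.isHermitian hcare hx
  refine posDef_iff_isHermitian_and_quadratic_pos.2 ⟨hP.isHermitian, fun x hx => ?_⟩
  refine (quadratic_nonneg hP x).lt_of_ne' fun hPx => hx (hobs x fun k => ?_)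
  have horbit : P *ᵥ ((A ^ k) *ᵥ x) = 0 := by
    induction k with
    | zero => simpa using mulVec_eq_zero_of_quadratic_eq_zero hP hPx
    | succ k ih =>
      rw [pow_succ', ← mulVec_mulVec]
      exact (hkernel ih).2
  rw [← mulVec_mulVec]
  exact (hkernel horbit).1

end Observability

section ParameterDependence

variable {n m p q : ℕ} {A : (Fin p → ℝ) → Matrix (Fin n) (Fin n) ℝ} {B : Matrix (Fin n) (Fin m) ℝ}
  {C : Matrix (Fin q) (Fin n) ℝ} {Q : Matrix (Fin n) (Fin n) ℝ} {R : Matrix (Fin m) (Fin m) ℝ}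
  {S : Set (Fin p → ℝ)}

theorem exists_posSemidef_solvesCARE {A : Matrix (Fin n) (Fin n) ℝ} (hR : R.PosDef)
    (hstab : IsStabilizable A B) (hdet : IsDetectable A C) :
    ∃ P : Matrix (Fin n) (Fin n) ℝ, P.PosSemidef ∧ SolvesCARE A B (Cᵀ * C) R P := by
  obtain ⟨F, hF⟩ := hstab
  obtain ⟨L, hL⟩ := hdet
  obtain ⟨V, hV⟩ := hF.exists_isLyapunovMatrix
  obtain ⟨W, hW⟩ := hL.exists_isLyapunovMatrix
  exact exists_posSemidef_riccatiResidual_eq_zero hV hW hR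

theorem exists_trace_le_of_solvesCARE (hA : ContinuousOn A S) (hS : IsCompact S)
    (Q : Matrix (Fin n) (Fin n) ℝ) (hR : R.PosDef) (hstab : ∀ ρ ∈ S, IsStabilizable (A ρ) B) :
    ∃ c : ℝ, ∀ ρ ∈ S, ∀ P : Matrix (Fin n) (Fin n) ℝ, P.IsHermitian → SolvesCARE (A ρ) B Q R P →
      P.trace ≤ c := by
  refine hS.induction_on (p := fun S' => ∃ c : ℝ, ∀ ρ ∈ S', ∀ P : Matrix (Fin n) (Fin n) ℝ,
    P.IsHermitian → SolvesCARE (A ρ) B Q R P → P.trace ≤ c) ⟨0, by simp⟩ ?_ ?_ fun ρ hρ => ?_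
  · rintro s t hst ⟨c, hc⟩
    exact ⟨c, fun ρ hρ => hc ρ (hst hρ)⟩
  · rintro s t ⟨c, hc⟩ ⟨d, hd⟩
    refine ⟨max c d, fun ρ hρ P hP hcare => hρ.elim (fun hρ => ?_) (fun hρ => ?_)⟩
    · exact (hc ρ hρ P hP hcare).trans (le_max_left _ _)
    · exact (hd ρ hρ P hP hcare).trans (le_max_right _ _)
  · obtain ⟨F, hF⟩ := hstab ρ hρ
    obtain ⟨W, hW⟩ := hF.exists_isLyapunovMatrix
    obtain ⟨c, hc⟩ := eventually_trace_le_of_riccatiResidual_eq_zero hW Q hR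
    exact ⟨_, (hA ρ hρ).eventually hc, c, fun _ h => h⟩

theorem isCompact_feasibleSemidef (hA : ContinuousOn A S) (hS : IsCompact S)
    (Q : Matrix (Fin n) (Fin n) ℝ) (hR : R.PosDef) (hstab : ∀ ρ ∈ S, IsStabilizable (A ρ) B) :
    IsCompact (feasibleSemidef A B Q R S) := by
  obtain ⟨c, hc⟩ := exists_trace_le_of_solvesCARE hA hS Q hR hstab
  set D : Set (Matrix (Fin n) (Fin n) ℝ × (Fin p → ℝ)) :=
    {P | P.PosSemidef ∧ P.trace ≤ c} ×ˢ S
  have hD : IsCompact D := (isCompact_setOf_posSemidef_and_trace_le c).prod hS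
  have hresidual : ContinuousOn (fun z => riccatiResidual (A z.2) B Q R z.1) D := by
    have : ContinuousOn (fun z => A z.2) D := hA.comp continuousOn_snd fun z hz => hz.2
    unfold riccatiResidual
    fun_prop
  have hsolutions := hD.of_isClosed_subset
    (hresidual.preimage_isClosed_of_isClosed hD.isClosed (isClosed_singleton (x := 0)))
    inter_subset_left
  convert! hsolutions.image (f := fun z => (riccatiGain B R z.1, z.1, z.2))
    (by unfold riccatiGain; fun_prop) using 1
  ext ⟨K, P, ρ⟩
  constructor
  · rintro ⟨hcare, rfl, hρ, hP⟩
    exact ⟨(P, ρ), ⟨⟨⟨hP, hc ρ hρ P hP.isHermitian hcare⟩, hρ⟩, hcare⟩, rfl⟩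
  · rintro ⟨⟨P, ρ⟩, ⟨⟨⟨hP, -⟩, hρ⟩, hcare⟩, ⟨⟩⟩
    exact ⟨hcare, rfl, hρ, hP⟩

theorem feasibleDef_eq_feasibleSemidef (hobs : ∀ ρ ∈ S, IsObservable (A ρ) C) :
    feasibleDef A B (Cᵀ * C) R S = feasibleSemidef A B (Cᵀ * C) R S := by
  ext ⟨K, P, ρ⟩
  exact ⟨fun ⟨hcare, hK, hρ, hP⟩ => ⟨hcare, hK, hρ, hP.posSemidef⟩,
    fun ⟨hcare, hK, hρ, hP⟩ => ⟨hcare, hK, hρ, hcare.posDef_of_isObservable (hobs ρ hρ) hP⟩⟩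

theorem exists_areOptimalBounds
    {F : Set (Matrix (Fin m) (Fin n) ℝ × Matrix (Fin n) (Fin n) ℝ × (Fin p → ℝ))}
    (hF : IsCompact F) (hne : F.Nonempty) : ∃ lo hi, AreOptimalBounds F lo hi := by
  have hentry (i : Fin n × Fin m) : IsCompact ((fun z => z.1.vec i) '' F) :=
    hF.image (by unfold Matrix.vec; fun_prop)
  choose lo hlo using fun i => (hentry i).exists_isLeast (hne.image _)
  choose hi hhi using fun i => (hentry i).exists_isGreatest (hne.image _)
  exact ⟨lo, hi, fun i => ⟨hlo i, hhi i⟩⟩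

theorem AreOptimalBounds.vec_mem_hyperrectangle
    {F : Set (Matrix (Fin m) (Fin n) ℝ × Matrix (Fin n) (Fin n) ℝ × (Fin p → ℝ))}
    {lo hi : Fin n × Fin m → ℝ} (h : AreOptimalBounds F lo hi)
    {z : Matrix (Fin m) (Fin n) ℝ × Matrix (Fin n) (Fin n) ℝ × (Fin p → ℝ)} (hz : z ∈ F) :
    z.1.vec ∈ hyperrectangle lo hi := fun i _ =>
  ⟨(h i).1.2 ⟨z, hz, rfl⟩, (h i).2.2 ⟨z, hz, rfl⟩⟩

theorem existsUnique_isOptimalGain {A : Matrix (Fin n) (Fin n) ℝ} (hR : R.PosDef)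
    (hstab : IsStabilizable A B) (hdet : IsDetectable A C) :
    ∃! K : Matrix (Fin m) (Fin n) ℝ, IsOptimalGain A B (Cᵀ * C) R K := by
  obtain ⟨P, hP, hcare⟩ := exists_posSemidef_solvesCARE hR hstab hdet
  exact ⟨riccatiGain B R P, hcare.isOptimalGain_riccatiGain hdet hR hP,
    fun K hK => hK.eq_riccatiGain hcare hdet hR hP⟩

theorem exists_mem_feasibleSemidef_of_mem_optimalGains (hR : R.PosDef)
    (hstab : ∀ ρ ∈ S, IsStabilizable (A ρ) B) (hdet : ∀ ρ ∈ S, IsDetectable (A ρ) C)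
    {K : Matrix (Fin m) (Fin n) ℝ} (hK : K ∈ optimalGains A B (Cᵀ * C) R S) :
    ∃ P ρ, (K, P, ρ) ∈ feasibleSemidef A B (Cᵀ * C) R S := by
  obtain ⟨ρ, hρ, hopt⟩ := hK
  obtain ⟨P, hP, hcare⟩ := exists_posSemidef_solvesCARE hR (hstab ρ hρ) (hdet ρ hρ)
  exact ⟨P, ρ, hcare, hopt.eq_riccatiGain hcare (hdet ρ hρ) hR hP, hρ, hP⟩

theorem continuous_lpvMatrix (A₀ : Matrix (Fin n) (Fin n) ℝ)
    (A : Fin p → Matrix (Fin n) (Fin n) ℝ) : Continuous (lpvMatrix A₀ A) := by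
  unfold lpvMatrix
  fun_prop

theorem IsPolytope.isCompact (hS : IsPolytope S) : IsCompact S := by
  obtain ⟨V, hV, rfl⟩ := hS
  exact hV.isCompact_convexHull ℝ

theorem transpose_matSqrt_mul_matSqrt (hQ : Q.PosSemidef) : (matSqrt Q)ᵀ * matSqrt Q = Q := by
  have hsymm : (matSqrt Q)ᵀ = matSqrt Q :=
    isHermitian_iff_isSymm.1 (nonneg_iff_posSemidef.1 (CFC.sqrt_nonneg Q)).isHermitian
  rw [hsymm]
  exact CFC.sqrt_mul_sqrt_self Q hQ.nonneg

end ParameterDependence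

theorem mainTheorem7_general {n m p q : ℕ} (A : (Fin p → ℝ) → Matrix (Fin n) (Fin n) ℝ)
    (B : Matrix (Fin n) (Fin m) ℝ) (C : Matrix (Fin q) (Fin n) ℝ) (R : Matrix (Fin m) (Fin m) ℝ)
    (S : Set (Fin p → ℝ)) (hS : IsCompact S) (hne : S.Nonempty) (hA : ContinuousOn A S)
    (hR : R.PosDef) (hstab : ∀ ρ ∈ S, IsStabilizable (A ρ) B)
    (hdet : ∀ ρ ∈ S, IsDetectable (A ρ) C) :
    (∀ ρ ∈ S, ∃! K : Matrix (Fin m) (Fin n) ℝ, IsOptimalGain (A ρ) B (Cᵀ * C) R K) ∧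
    (∃ lo hi : Fin n × Fin m → ℝ,
      AreOptimalBounds (feasibleSemidef A B (Cᵀ * C) R S) lo hi ∧
      Matrix.vec '' optimalGains A B (Cᵀ * C) R S ⊆ hyperrectangle lo hi) ∧
    ((∀ ρ ∈ S, IsObservable (A ρ) C) →
      ∃ lo hi : Fin n × Fin m → ℝ,
        AreOptimalBounds (feasibleDef A B (Cᵀ * C) R S) lo hi ∧
        Matrix.vec '' optimalGains A B (Cᵀ * C) R S ⊆ hyperrectangle lo hi) := by
  have hbounds : ∃ lo hi : Fin n × Fin m → ℝ,
      AreOptimalBounds (feasibleSemidef A B (Cᵀ * C) R S) lo hi ∧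
      Matrix.vec '' optimalGains A B (Cᵀ * C) R S ⊆ hyperrectangle lo hi := by
    obtain ⟨ρ₀, hρ₀⟩ := hne
    obtain ⟨P₀, hP₀, hcare₀⟩ := exists_posSemidef_solvesCARE hR (hstab ρ₀ hρ₀) (hdet ρ₀ hρ₀)
    obtain ⟨lo, hi, hb⟩ := exists_areOptimalBounds
      (isCompact_feasibleSemidef hA hS (Cᵀ * C) hR hstab)
      ⟨(riccatiGain B R P₀, P₀, ρ₀), hcare₀, rfl, hρ₀, hP₀⟩
    refine ⟨lo, hi, hb, image_subset_iff.2 fun K hK => ?_⟩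
    obtain ⟨P, ρ, hfeasible⟩ := exists_mem_feasibleSemidef_of_mem_optimalGains hR hstab hdet hK
    exact hb.vec_mem_hyperrectangle hfeasible
  exact ⟨fun ρ hρ => existsUnique_isOptimalGain hR (hstab ρ hρ) (hdet ρ hρ), hbounds,
    fun hobs => feasibleDef_eq_feasibleSemidef hobs ▸ hbounds⟩

theorem mainTheorem7 {n m p : ℕ}
    (A₀ : Matrix (Fin n) (Fin n) ℝ) (A : Fin p → Matrix (Fin n) (Fin n) ℝ)
    (B : Matrix (Fin n) (Fin m) ℝ)
    (Q : Matrix (Fin n) (Fin n) ℝ) (R : Matrix (Fin m) (Fin m) ℝ)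
    (S : Set (Fin p → ℝ)) (hS : IsPolytope S) (hne : S.Nonempty)
    (hR : R.PosDef) (hQ : Q.PosSemidef)
    (hstab : ∀ ρ ∈ S, IsStabilizable (lpvMatrix A₀ A ρ) B)
    (hdet : ∀ ρ ∈ S, IsDetectable (lpvMatrix A₀ A ρ) (matSqrt Q)) :
    (∀ ρ ∈ S, ∃! K : Matrix (Fin m) (Fin n) ℝ, IsOptimalGain (lpvMatrix A₀ A ρ) B Q R K) ∧
    (∃ lo hi : Fin n × Fin m → ℝ,
      AreOptimalBounds (feasibleSemidef (lpvMatrix A₀ A) B Q R S) lo hi ∧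
      Matrix.vec '' optimalGains (lpvMatrix A₀ A) B Q R S ⊆ hyperrectangle lo hi) ∧
    ((∀ ρ ∈ S, IsObservable (lpvMatrix A₀ A ρ) (matSqrt Q)) →
      ∃ lo hi : Fin n × Fin m → ℝ,
        AreOptimalBounds (feasibleDef (lpvMatrix A₀ A) B Q R S) lo hi ∧
        Matrix.vec '' optimalGains (lpvMatrix A₀ A) B Q R S ⊆ hyperrectangle lo hi) := by
  have h := mainTheorem7_general (lpvMatrix A₀ A) B (matSqrt Q) R S hS.isCompact hne
    (continuous_lpvMatrix A₀ A).continuousOn hR hstab hdet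
  rwa [transpose_matSqrt_mul_matSqrt hQ] at h
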